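/- Let $d\ge 1$ and normalize the Fourier transform by $(\mathcal F f)(\xi)=\widehat f(\xi)=\int_{\mathbb R^d} f(x)e^{-2\pi i x\cdot\xi}\,dx$. For $p\in[1,2]$ and $1/p+1/p'=1$, let $\widehat f\in L^{p'}(\mathbb R^d)$ denote the Fourier transform of $f\in L^p(\mathbb R^d)$, i.e. the image of $f$ under the unique bounded linear operator $L^p(\mathbb R^d)\to L^{p'}(\mathbb R^d)$ that agrees with $\mathcal F$ on Schwartz functions. (a) Let $p\in[1,2)$. There is a finite constant $C$ depending only on $d$ and $p$ such that for every $f\in L^p(\mathbb R^d)$ $$\Big\|\sup_{R_1,\dots,R_d\in(0,\infty)}\big|\mathcal F\big(f\,\mathbf 1_{[-R_1,R_1]\times\cdots\times[-R_d,R_d]}\big)\big|\Big\|_{L^{p'}(\mathbb R^d)}\le C\,\|f\|_{L^p(\mathbb R^d)}.$$ Moreover, for every $f\in L^p(\mathbb R^d)$, $$\lim_{R_1\to\infty,\dots,R_d\to\infty}\int_{[-R_1,R_1]\times\cdots\times[-R_d,R_d]}f(x)e^{-2\pi i x\cdot\xi}\,dx=\widehat f(\xi)\quad\text{for a.e. }\xi\in\mathbb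 R^d,$$ where $R_1,\dots,R_d$ tend to infinity independently of each other. (b) If $d\ge2$, then there exist a function $f\in L^2(\mathbb R^d)$ and a measurable set $Q\subseteq\mathbb R^d$ of positive measure such that $$\limsup_{R_1\to\infty,\dots,R_d\to\infty}\Big|\int_{[-R_1,R_1]\times\cdots\times[-R_d,R_d]}f(x)e^{-2\pi i x\cdot\xi}\,dx\Big|=\infty\quad\text{for every }\xi\in Q.$$ In particular, even the weak $L^2$ estimate fails: there is no finite constant $C$ such that for every $f\in L^2(\mathbb R^d)$ $$\Big\|\sup_{R_1,\dots,R_d\in(0,\infty)}\big|\mathcal F\big(f\,\mathbf 1_{[-R_1,R_1]\times\cdots\times[-R_d,R_d]}\big)\big|\Big\|_{L^{2,\infty}(\mathbb R^d)}\le C\,\|f\|_{L^2(\mathbb R^d)},$$ where $\|g\|_{L^{2,\infty}(\mathbb R^d)}=\sup_{t>0}t\,|\{\xi:|g(\xi)|>t\}|^{1/2}$. -/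

import Mathlib

open MeasureTheory Filter Topology
open scoped ENNReal NNReal FourierTransform SchwartzMap

/-- The rectangle `[-R₁, R₁] × ⋯ × [-R_d, R_d]` in `ℝ^d`. -/
def centeredBox {d : ℕ} (R : Fin d → ℝ) : Set (EuclideanSpace ℝ (Fin d)) :=
  {x | ∀ j, x j ∈ Set.Icc (-R j) (R j)}

/-- The rectangular partial Fourier integral
`∫_{[-R₁, R₁] × ⋯ × [-R_d, R_d]} f(x) e^{-2πi x·ξ} dx`. -/
noncomputable def rectFourierIntegral {d : ℕ} (f : EuclideanSpace ℝ (Fin d) → ℂ)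
    (R : Fin d → ℝ) (ξ : EuclideanSpace ℝ (Fin d)) : ℂ :=
  ∫ x in centeredBox R, f x * Complex.exp (-2 * Real.pi * Complex.I * (∑ j, x j * ξ j : ℝ))

theorem measurableSet_centeredBox {d : ℕ} (R : Fin d → ℝ) : MeasurableSet (centeredBox R) := by
  have : centeredBox R = ⋂ j, (fun x : EuclideanSpace ℝ (Fin d) => x j) ⁻¹' Set.Icc (-R j) (R j) := by
    ext x; simp [centeredBox]
  rw [this]
  exact MeasurableSet.iInter fun j => measurableSet_Icc.preimage (by fun_prop)

/-- The partial Fourier integral is the Fourier transform of the truncated function. -/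
theorem fourier_indicator_centeredBox {d : ℕ} (f : EuclideanSpace ℝ (Fin d) → ℂ)
    (R : Fin d → ℝ) (ξ : EuclideanSpace ℝ (Fin d)) :
    𝓕 ((centeredBox R).indicator f) ξ = rectFourierIntegral f R ξ := by
  rw [Real.fourier_eq', rectFourierIntegral, ← integral_indicator (measurableSet_centeredBox R)]
  congr 1
  ext x
  by_cases hx : x ∈ centeredBox R
  · simp only [Set.indicator_of_mem hx, smul_eq_mul, PiLp.inner_apply, RCLike.inner_apply,
      conj_trivial]
    rw [mul_comm]
    congr 2
    push_cast
    simp only [Finset.mul_sum, Finset.sum_mul]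
    exact Finset.sum_congr rfl fun j _ => by ring
  · simp [Set.indicator_of_notMem hx]

/-- The maximal function
`sup_{R₁, …, R_d ∈ (0, ∞)} |𝓕(f 𝟙_{[-R₁, R₁] × ⋯ × [-R_d, R_d]})(ξ)|`, with values in `[0, ∞]`. -/
noncomputable def maximalRectFourier {d : ℕ} (f : EuclideanSpace ℝ (Fin d) → ℂ)
    (ξ : EuclideanSpace ℝ (Fin d)) : ℝ≥0∞ :=
  ⨆ (R : Fin d → ℝ) (_ : ∀ j, 0 < R j), ‖𝓕 ((centeredBox R).indicator f) ξ‖ₑ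

/-- `T` is the Fourier transform `L^p(ℝ^d) → L^q(ℝ^d)`: a bounded linear operator which agrees with
the classical Fourier transform on Schwartz functions. -/
def IsFourierExtension {d : ℕ} {p q : ℝ≥0∞} [Fact (1 ≤ p)] [Fact (1 ≤ q)]
    (T : Lp (α := EuclideanSpace ℝ (Fin d)) ℂ p volume →L[ℂ]
      Lp (α := EuclideanSpace ℝ (Fin d)) ℂ q volume) : Prop :=
  ∀ φ : 𝓢(EuclideanSpace ℝ (Fin d), ℂ), T (φ.toLp p volume) = (𝓕 φ).toLp q volume

/-- Such an operator is unique when `p < ∞`, by density of the Schwartz functions. -/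
theorem IsFourierExtension.unique {d : ℕ} {p q : ℝ≥0∞} [Fact (1 ≤ p)] [Fact (1 ≤ q)] (hp : p ≠ ⊤)
    {T T' : Lp (α := EuclideanSpace ℝ (Fin d)) ℂ p volume →L[ℂ]
      Lp (α := EuclideanSpace ℝ (Fin d)) ℂ q volume}
    (hT : IsFourierExtension T) (hT' : IsFourierExtension T') : T = T' := by
  have hd : DenseRange (SchwartzMap.toLpCLM ℂ (E := EuclideanSpace ℝ (Fin d)) ℂ p volume) :=
    SchwartzMap.denseRange_toLpCLM hp
  refine ContinuousLinearMap.coeFn_injective (hd.equalizer T.continuous T'.continuous ?_)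
  funext φ
  exact (hT φ).trans (hT' φ).symm

/-- The weak `L^2` quasinorm `sup_{t > 0} t |{g > t}|^{1/2}` of a function with values in `[0, ∞]`. -/
noncomputable def weakL2Norm {α : Type*} [MeasurableSpace α] (μ : Measure α) (g : α → ℝ≥0∞) : ℝ≥0∞ :=
  ⨆ t : ℝ≥0, (t : ℝ≥0∞) * μ {x | (t : ℝ≥0∞) < g x} ^ (1 / 2 : ℝ)

/-! Part (a). For p = 1 the maximal function is bounded pointwise by ‖f‖₁. For 1 < p < 2 the Fourier
transform maps L^p to L^{p'} with p < p' (Hausdorff-Young), and this strict gap is what the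
Christ-Kiselev lemma needs (`IsSublinearBounded.lintegral_maxTrunc_le`). To control all truncations
to {φ ≤ r}, cut at the level where the mass of |f|^p is halved and recurse on both sides. The two
halves live in L^p but are recombined in ℓ^{p'}, so each generation gains a factor 2^{1/p' - 1/p} <
1. The maximal truncation is itself sublinear and bounded from L^p to L^{p'}, so the lemma can be
applied once for each function |x_j|, which handles independent side lengths
(`exists_multiparameter_maximal`). The constant does not depend on the finite set of levels, and
monotone convergence over rational boxes gives the full supremum. Almost everywhere convergence
follows by approximation with Schwartz functions.

Part (b). For the chirp exp(-2πi x₀x₁/N), the phase at frequency ξ is (x₀ + ξ₁N)(x₁ + ξ₀N)/N up to a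
constant. The rectangle with half sides ξ₁N and ξ₀N has the saddle of this phase at a corner, and
there the integral is at least a multiple of N log N (`sum_le_norm_integral_exp`), while the L² norm
of the chirp on a square of side comparable to N is only of order N. A gliding hump with rapidly
growing scales N_k and weights 2^{-k}/N_k is in L², and its rectangular integrals are unbounded on
an open set of frequencies. There the maximal function is infinite, which excludes a weak L² bound.
-/

section Plancherel

/-! ### Plancherel for the Fourier integral of functions in L¹ ∩ L². -/

variable {V : Type*} [NormedAddCommGroup V] [InnerProductSpace ℝ V] [FiniteDimensional ℝ V]
  [MeasurableSpace V] [BorelSpace V]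

theorem continuous_fourier_of_integrable {f : V → ℂ} (hf : Integrable f) : Continuous (𝓕 f) :=
  VectorFourier.fourierIntegral_continuous Real.continuous_fourierChar
    (by simpa using continuous_inner) hf

theorem enorm_fourier_le_eLpNorm_one (f : V → ℂ) (ξ : V) : ‖𝓕 f ξ‖ₑ ≤ eLpNorm f 1 volume := by
  rw [Real.fourier_eq, eLpNorm_one_eq_lintegral_enorm]
  refine (enorm_integral_le_lintegral_enorm _).trans (lintegral_mono fun x => ?_)
  rw [← ofReal_norm, ← ofReal_norm, Circle.norm_smul]

/-- The `L²` Fourier transform of an integrable function is given by the Fourier integral. -/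
theorem fourier_toLp_two_ae_eq {f : V → ℂ} (hf1 : Integrable f) (hf2 : MemLp f 2 volume) :
    (𝓕 (hf2.toLp f) : Lp (α := V) ℂ 2 volume) =ᵐ[volume] 𝓕 f := by
  set F : Lp (α := V) ℂ 2 volume := 𝓕 (hf2.toLp f) with hF
  -- Both sides are locally integrable, so it suffices to test against smooth compactly supported
  -- functions; there the transform is moved onto the test function, on one side by the
  -- distributional definition and on the other by Fubini.
  refine ae_eq_of_integral_contDiff_smul_eq
    ((Lp.memLp F).locallyIntegrable (by norm_num))
    (continuous_fourier_of_integrable hf1).locallyIntegrable fun g hg1 hg2 => ?_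
  have hg1' : ContDiff ℝ (⊤ : ℕ∞) (fun x => (g x : ℂ)) := Complex.ofRealCLM.contDiff.comp hg1
  have hg2' : HasCompactSupport (fun x => (g x : ℂ)) := hg2.comp_left Complex.ofReal_zero
  set G : 𝓢(V, ℂ) := hg2'.toSchwartzMap hg1' with hG
  have hGx : ∀ x, G x = (g x : ℂ) := fun x => rfl
  have h := congrArg (fun D : 𝓢'(V, ℂ) => D G) (Lp.fourier_toTemperedDistribution_eq (hf2.toLp f))
  simp only [TemperedDistribution.fourier_apply, Lp.toTemperedDistribution_apply] at h
  have h1 : ∫ x, g x • F x = ∫ x, G x • F x := by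
    refine integral_congr_ae (Eventually.of_forall fun x => ?_)
    simp [hGx]
  have h2 : ∫ x, g x • 𝓕 f x = ∫ x, 𝓕 f x • G x := by
    refine integral_congr_ae (Eventually.of_forall fun x => ?_)
    simp [hGx, mul_comm]
  rw [h1, h2, ← h]
  have h3 : ∫ x, 𝓕 f x • G x = ∫ x, f x • 𝓕 (G : V → ℂ) x := by
    have := VectorFourier.integral_fourierIntegral_smul_eq_flip (L := innerₗ V)
      Real.continuous_fourierChar (by simpa using continuous_inner) hf1 (G.integrable (μ := volume))
    rw [flip_innerₗ] at this
    exact this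
  rw [h3]
  refine integral_congr_ae ?_
  filter_upwards [hf2.coeFn_toLp] with x hx
  rw [hx, SchwartzMap.fourier_coe, smul_eq_mul, smul_eq_mul, mul_comm]

theorem eLpNorm_two_fourier {f : V → ℂ} (hf1 : Integrable f) (hf2 : MemLp f 2 volume) :
    eLpNorm (𝓕 f) 2 volume = eLpNorm f 2 volume := by
  rw [← eLpNorm_congr_ae (fourier_toLp_two_ae_eq hf1 hf2), ← eLpNorm_congr_ae hf2.coeFn_toLp]
  have := Lp.norm_fourier_eq (hf2.toLp f)
  rw [Lp.norm_def, Lp.norm_def] at this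
  exact (ENNReal.toReal_eq_toReal_iff' (Lp.eLpNorm_ne_top _) (Lp.eLpNorm_ne_top _)).1 this

theorem lintegral_enorm_fourier_sq {f : V → ℂ} (hf1 : Integrable f) (hf2 : MemLp f 2 volume) :
    ∫⁻ ξ, ‖𝓕 f ξ‖ₑ ^ 2 = ∫⁻ x, ‖f x‖ₑ ^ 2 := by
  have h := eLpNorm_two_fourier hf1 hf2
  rw [eLpNorm_eq_lintegral_rpow_enorm_toReal (by norm_num) (by norm_num),
    eLpNorm_eq_lintegral_rpow_enorm_toReal (by norm_num) (by norm_num)] at h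
  have := ENNReal.rpow_left_injective (x := 1 / (2 : ℝ≥0∞).toReal) (by norm_num) h
  simpa using this

end Plancherel

/-! ### Hausdorff-Young by real interpolation. -/

section HausdorffYoung

variable {V : Type*} [NormedAddCommGroup V] [InnerProductSpace ℝ V] [FiniteDimensional ℝ V]
  [MeasurableSpace V] [BorelSpace V]

theorem fourier_add_of_integrable {f g : V → ℂ} (hf : Integrable f) (hg : Integrable g) :
    𝓕 (f + g) = 𝓕 f + 𝓕 g :=
  VectorFourier.fourierIntegral_add (L := innerₗ V) Real.continuous_fourierChar
    (by simpa using continuous_inner) hf hg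

theorem ofReal_norm_rpow (z : ℂ) {r : ℝ} (hr : 0 ≤ r) : ENNReal.ofReal (‖z‖ ^ r) = ‖z‖ₑ ^ r := by
  rw [← ENNReal.ofReal_rpow_of_nonneg (norm_nonneg _) hr, ofReal_norm]

/-- Weak-type bound for the Fourier transform at height `s`, from the `L¹ → L^∞` bound for the part
of `f` above the height `s ^ (-1 / (p - 1))` and Plancherel for the part below. -/
theorem volume_fourier_gt_le {p s : ℝ} (hp1 : 1 < p) (hs : 0 < s) {f : V → ℂ} (hfm : Measurable f)
    (hf1 : Integrable f) (hA : ∫⁻ x, ‖f x‖ₑ ^ p ≤ 1) :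
    volume {ξ | s < ‖𝓕 f ξ‖ / 2} ≤
      ENNReal.ofReal (s ^ (-2 : ℝ)) *
        ∫⁻ x, {x | s * ‖f x‖ ^ (p - 1) ≤ 1}.indicator (fun x => ‖f x‖ₑ ^ 2) x := by
  set S : Set V := {x | s * ‖f x‖ ^ (p - 1) ≤ 1} with hS
  have hSm : MeasurableSet S := measurableSet_le (by fun_prop) measurable_const
  set g := S.indicator f with hg
  set h := Sᶜ.indicator f with hh
  have hgi : Integrable g := hf1.indicator hSm
  have hhi : Integrable h := hf1.indicator hSm.compl
  have hsum : 𝓕 f = 𝓕 g + 𝓕 h := by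
    rw [← fourier_add_of_integrable hgi hhi, hg, hh, Set.indicator_self_add_compl]
  -- Off S one has |f| ≤ s|f|^p, so the normalization of f gives the L¹ bound.
  have hh1 : eLpNorm h 1 volume ≤ ENNReal.ofReal s := by
    rw [eLpNorm_one_eq_lintegral_enorm]
    calc ∫⁻ x, ‖h x‖ₑ ≤ ∫⁻ x, ENNReal.ofReal s * ‖f x‖ₑ ^ p := by
          refine lintegral_mono fun x => ?_
          by_cases hx : x ∈ S
          · simp [hh, hx]
          · have hx' : 1 < s * ‖f x‖ ^ (p - 1) := by simpa [hS] using hx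
            have hpos : 0 < ‖f x‖ := by
              rcases (norm_nonneg (f x)).eq_or_lt with h0 | h0
              · rw [← h0, Real.zero_rpow (by linarith)] at hx'; linarith
              · exact h0
            rw [hh, Set.indicator_of_mem (by exact hx), ← ofReal_norm_rpow _ (by linarith),
              ← ENNReal.ofReal_mul hs.le, ← ofReal_norm]
            refine ENNReal.ofReal_le_ofReal ?_
            have : ‖f x‖ ^ p = ‖f x‖ ^ (p - 1) * ‖f x‖ := by
              rw [← Real.rpow_add_one hpos.ne']; congr 1; ring
            rw [this, ← mul_assoc]
            nlinarith
      _ = ENNReal.ofReal s * ∫⁻ x, ‖f x‖ₑ ^ p := lintegral_const_mul _ (by fun_prop)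
      _ ≤ _ := by simpa using mul_le_mul_right hA (ENNReal.ofReal s)
  -- On S the function f is bounded by s^{-1/(p-1)}, and a bounded integrable function is square
  -- integrable.
  have hg2 : MemLp g 2 volume := by
    rw [memLp_two_iff_integrable_sq_norm hgi.1]
    refine Integrable.mono' (hf1.norm.const_mul ((1 / s) ^ (1 / (p - 1)))) (by fun_prop)
      (Eventually.of_forall fun x => ?_)
    by_cases hx : x ∈ S
    · have hx' : s * ‖f x‖ ^ (p - 1) ≤ 1 := hx
      have h1 : ‖f x‖ ≤ (1 / s) ^ (1 / (p - 1)) := by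
        have h2 : ‖f x‖ ^ (p - 1) ≤ 1 / s := by rwa [le_div_iff₀' hs]
        calc ‖f x‖ = (‖f x‖ ^ (p - 1)) ^ (1 / (p - 1)) := by
              rw [← Real.rpow_mul (norm_nonneg _), mul_one_div_cancel (by linarith), Real.rpow_one]
          _ ≤ _ := Real.rpow_le_rpow (by positivity) h2 (by
            apply one_div_nonneg.2; linarith)
      simp only [hg, Set.indicator_of_mem hx, norm_pow, norm_norm]
      nlinarith [norm_nonneg (f x)]
    · simp only [hg, Set.indicator_of_notMem hx]
      simp; positivity
  -- Since |𝓕 h| ≤ s, a value of |𝓕 f| above 2s forces |𝓕 g| to exceed s.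
  have hsub : {ξ | s < ‖𝓕 f ξ‖ / 2} ⊆ {ξ | ENNReal.ofReal (s ^ 2) ≤ ‖𝓕 g ξ‖ₑ ^ 2} := by
    intro ξ hξ
    simp only [Set.mem_ofPred_eq] at hξ ⊢
    have h1 : ‖𝓕 h ξ‖ ≤ s := by
      have := (enorm_fourier_le_eLpNorm_one h ξ).trans hh1
      rw [← ofReal_norm] at this
      exact (ENNReal.ofReal_le_ofReal_iff hs.le).1 this
    have h2 : ‖𝓕 f ξ‖ ≤ ‖𝓕 g ξ‖ + ‖𝓕 h ξ‖ := by
      rw [hsum]; exact norm_add_le _ _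
    rw [← ofReal_norm, ← ENNReal.ofReal_pow (norm_nonneg _)]
    refine ENNReal.ofReal_le_ofReal ?_
    gcongr
    linarith
  have hcheb := mul_meas_ge_le_lintegral
    (((continuous_fourier_of_integrable hgi).enorm.measurable).pow_const 2)
    (ENNReal.ofReal (s ^ 2)) (μ := volume)
  rw [lintegral_enorm_fourier_sq hgi hg2] at hcheb
  have hgS : ∀ x, ‖g x‖ₑ ^ 2 = S.indicator (fun x => ‖f x‖ₑ ^ 2) x := by
    intro x; by_cases hx : x ∈ S <;> simp [hg, hx]
  simp only [hgS] at hcheb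
  refine (measure_mono hsub).trans ?_
  have hs2 : ENNReal.ofReal (s ^ (-2 : ℝ)) * ENNReal.ofReal (s ^ 2) = 1 := by
    rw [← ENNReal.ofReal_mul (by positivity), Real.rpow_neg hs.le]
    norm_cast
    rw [inv_mul_cancel₀ (by positivity)]; simp
  calc _ = ENNReal.ofReal (s ^ (-2 : ℝ)) * (ENNReal.ofReal (s ^ 2) *
        volume {ξ | ENNReal.ofReal (s ^ 2) ≤ ‖𝓕 g ξ‖ₑ ^ 2}) := by rw [← mul_assoc, hs2, one_mul]
    _ ≤ _ := by gcongr

theorem lintegral_Ioc_rpow {c r : ℝ} (hc : 0 ≤ c) (hr : -1 < r) :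
    ∫⁻ s in Set.Ioc 0 c, ENNReal.ofReal (s ^ r) = ENNReal.ofReal (c ^ (r + 1) / (r + 1)) := by
  rw [← ofReal_integral_eq_lintegral_ofReal, ← intervalIntegral.integral_of_le hc,
    integral_rpow (Or.inl hr), Real.zero_rpow (by linarith), sub_zero]
  · exact (intervalIntegrable_iff_integrableOn_Ioc_of_le hc).1
      (intervalIntegral.intervalIntegrable_rpow' hr)
  · exact (ae_restrict_mem measurableSet_Ioc).mono fun s hs => Real.rpow_nonneg hs.1.le _

/-- Integrate the distributional bound by layer cake and exchange the integrals: since the cut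
height varies with s, each x contributes |f(x)|² times an integral of s^{q-3} over a bounded
interval. That integral converges at 0 exactly because q > 2. -/
theorem lintegral_fourier_rpow_le_of_le_one {p q : ℝ} (hp2 : p < 2) (hpq : p.HolderConjugate q)
    {f : V → ℂ} (hfm : Measurable f) (hf1 : Integrable f) (hA : ∫⁻ x, ‖f x‖ₑ ^ p ≤ 1) :
    ∫⁻ ξ, ‖𝓕 f ξ‖ₑ ^ q ≤ ENNReal.ofReal (2 ^ q * (q / (q - 2))) := by
  have hp1 : 1 < p := hpq.lt
  have hq1 : 1 < q := hpq.symm.lt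
  have hpq' : (p - 1) * (q - 1) = 1 := by nlinarith [hpq.mul_eq_add]
  have hq2 : 2 < q := by nlinarith
  have hfc := continuous_fourier_of_integrable hf1
  have hlayer := lintegral_rpow_eq_lintegral_meas_lt_mul (volume : Measure V)
    (f := fun ξ => ‖𝓕 f ξ‖ / 2) (Eventually.of_forall fun ξ => by positivity)
    (by fun_prop) (p := q) (by linarith)
  have hscale : ∫⁻ ξ, ‖𝓕 f ξ‖ₑ ^ q =
      ENNReal.ofReal (2 ^ q) * ∫⁻ ξ, ENNReal.ofReal ((‖𝓕 f ξ‖ / 2) ^ q) := by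
    rw [← lintegral_const_mul _ (by fun_prop)]
    refine lintegral_congr fun ξ => ?_
    rw [← ENNReal.ofReal_mul (by positivity), ← Real.mul_rpow (by norm_num) (by positivity),
      mul_div_cancel₀ _ (two_ne_zero), ofReal_norm_rpow _ (by linarith)]
  set S : ℝ → Set V := fun s => {x | s * ‖f x‖ ^ (p - 1) ≤ 1} with hS
  have hmain : ∫⁻ s in Set.Ioi 0, volume {ξ | s < ‖𝓕 f ξ‖ / 2} * ENNReal.ofReal (s ^ (q - 1)) ≤
      ENNReal.ofReal (1 / (q - 2)) := by
    calc _ ≤ ∫⁻ s in Set.Ioi (0 : ℝ), ∫⁻ x, ENNReal.ofReal (s ^ (q - 3)) *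
          (S s).indicator (fun x => ‖f x‖ₑ ^ 2) x := by
          refine setLIntegral_mono' measurableSet_Ioi fun s hs => ?_
          have hs : 0 < s := hs
          rw [lintegral_const_mul _ ((by fun_prop : Measurable fun x => ‖f x‖ₑ ^ 2).indicator
            (measurableSet_le (by fun_prop) measurable_const))]
          calc _ ≤ (ENNReal.ofReal (s ^ (-2 : ℝ)) *
                ∫⁻ x, (S s).indicator (fun x => ‖f x‖ₑ ^ 2) x) * ENNReal.ofReal (s ^ (q - 1)) := by
                gcongr; exact volume_fourier_gt_le hp1 hs hfm hf1 hA
            _ = _ := by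
                rw [mul_right_comm, ← ENNReal.ofReal_mul (by positivity), ← Real.rpow_add hs]
                rw [show (-2 : ℝ) + (q - 1) = q - 3 by ring]
      _ = ∫⁻ x, ∫⁻ s in Set.Ioi (0 : ℝ), ENNReal.ofReal (s ^ (q - 3)) *
          (S s).indicator (fun x => ‖f x‖ₑ ^ 2) x := by
          refine lintegral_lintegral_swap (Measurable.aemeasurable ?_)
          refine Measurable.mul (by fun_prop) ?_
          have : (Function.uncurry fun (s : ℝ) (x : V) => (S s).indicator (fun x => ‖f x‖ₑ ^ 2) x) =
              {z : ℝ × V | z.1 * ‖f z.2‖ ^ (p - 1) ≤ 1}.indicator (fun z => ‖f z.2‖ₑ ^ 2) := by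
            ext ⟨s, x⟩; simp [Set.indicator, hS]
          change Measurable (Function.uncurry fun (s : ℝ) (x : V) =>
            (S s).indicator (fun x => ‖f x‖ₑ ^ 2) x)
          rw [this]
          exact (by fun_prop : Measurable fun z : ℝ × V => ‖f z.2‖ₑ ^ 2).indicator
            (measurableSet_le (by fun_prop) measurable_const)
      _ ≤ ∫⁻ x, ENNReal.ofReal (1 / (q - 2)) * ‖f x‖ₑ ^ p := by
          refine lintegral_mono fun x => ?_
          dsimp only
          rcases (norm_nonneg (f x)).eq_or_lt with h0 | h0
          · have : f x = 0 := norm_eq_zero.1 h0.symm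
            have h : ∀ s, (S s).indicator (fun x => ‖f x‖ₑ ^ 2) x = 0 := fun s => by
              by_cases hx : x ∈ S s <;> simp [hx, this]
            simp [h]
          · set c : ℝ := ‖f x‖ ^ (-(p - 1)) with hc
            have hc0 : 0 < c := Real.rpow_pos_of_pos h0 _
            have hmem : ∀ s, x ∈ S s ↔ s ≤ c := fun s => by
              rw [hc, Real.rpow_neg h0.le, ← one_div, le_div_iff₀ (by positivity)]
              rfl
            have : ∀ s, ENNReal.ofReal (s ^ (q - 3)) * (S s).indicator (fun x => ‖f x‖ₑ ^ 2) x =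
                (Set.Iic c).indicator (fun s : ℝ => ENNReal.ofReal (s ^ (q - 3)) * ‖f x‖ₑ ^ 2) s :=
              fun s => by
                simp only [Set.indicator_apply, hmem, Set.mem_Iic, mul_ite, mul_zero]
            simp only [this]
            rw [setLIntegral_indicator measurableSet_Iic, Set.inter_comm, Set.Ioi_inter_Iic,
              lintegral_mul_const _ (by fun_prop), lintegral_Ioc_rpow hc0.le (by linarith),
              ← ofReal_norm_rpow _ (by linarith), ← ofReal_norm,
              ← ENNReal.ofReal_pow (norm_nonneg _),
              ← ENNReal.ofReal_mul (by apply div_nonneg <;> [positivity; linarith]),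
              ← ENNReal.ofReal_mul (by apply div_nonneg <;> linarith)]
            refine ENNReal.ofReal_le_ofReal (le_of_eq ?_)
            rw [hc, ← Real.rpow_mul h0.le, ← Real.rpow_natCast, div_mul_eq_mul_div,
              ← Real.rpow_add h0]
            -- Duality, in the form (p - 1)(q - 1) = 1, makes the exponents collapse to p.
            have e1 : -(p - 1) * (q - 3 + 1) + ((2 : ℕ) : ℝ) = p := by push_cast; nlinarith
            rw [e1]
            have e2 : q - 3 + 1 = q - 2 := by ring
            rw [e2]; ring
      _ = ENNReal.ofReal (1 / (q - 2)) * ∫⁻ x, ‖f x‖ₑ ^ p := lintegral_const_mul _ (by fun_prop)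
      _ ≤ _ := by simpa using mul_le_mul_right hA (ENNReal.ofReal (1 / (q - 2)))
  rw [hscale, hlayer, ENNReal.ofReal_mul (p := 2 ^ q) (by positivity), div_eq_mul_one_div q,
    ENNReal.ofReal_mul (p := q) (by linarith)]
  gcongr

/-- The Hausdorff-Young inequality, up to a constant. -/
theorem exists_lintegral_fourier_rpow_le {p q : ℝ} (hp2 : p < 2) (hpq : p.HolderConjugate q) :
    ∃ B : ℝ≥0, ∀ f : V → ℂ, Integrable f →
      (∫⁻ ξ, ‖𝓕 f ξ‖ₑ ^ q) ^ (1 / q) ≤ B * (∫⁻ x, ‖f x‖ₑ ^ p) ^ (1 / p) := by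
  have hp0 : 0 < p := hpq.pos
  have hq0 : 0 < q := hpq.symm.pos
  set K : ℝ := 2 ^ q * (q / (q - 2)) with hK
  -- The added 1 makes the constant visibly nonzero, as needed when the L^p norm of f is infinite.
  refine ⟨(Real.toNNReal K + 1) ^ (1 / q), fun f hf => ?_⟩
  wlog hfm : Measurable f generalizing f
  · obtain ⟨g, hg, hfg⟩ := hf.1.aemeasurable
    have h1 : 𝓕 f = 𝓕 g := funext fun ξ => Real.fourier_congr_ae hfg ξ
    rw [h1, show ∫⁻ x, ‖f x‖ₑ ^ p = ∫⁻ x, ‖g x‖ₑ ^ p from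
      lintegral_congr_ae (hfg.fun_comp fun z => ‖z‖ₑ ^ p)]
    exact this g (hf.congr hfg) hg
  rcases eq_or_ne (∫⁻ x, ‖f x‖ₑ ^ p) 0 with h0 | h0
  · have hf0 : f =ᵐ[volume] 0 := by
      rw [lintegral_eq_zero_iff (by fun_prop)] at h0
      filter_upwards [h0] with x hx
      simpa [hp0] using hx
    have h1 : 𝓕 f = 0 := funext fun ξ => by
      rw [Real.fourier_congr_ae hf0 ξ, Real.fourier_eq]; simp
    simp [h1, hq0]
  rcases eq_or_ne (∫⁻ x, ‖f x‖ₑ ^ p) ⊤ with hT | hT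
  · rw [hT, ENNReal.top_rpow_of_pos (by positivity), ENNReal.mul_top]
    · exact le_top
    · rw [ENNReal.coe_ne_zero]; positivity
  set a : ℝ≥0∞ := (∫⁻ x, ‖f x‖ₑ ^ p) ^ (1 / p) with ha
  have ha0 : a ≠ 0 := by simp [ha, h0, hT]
  have haT : a ≠ ⊤ := by simp [ha, h0, hT]
  set c : ℂ := ((a⁻¹.toReal : ℝ) : ℂ) with hc
  have hcn : ‖c‖ₑ = a⁻¹ := by
    rw [← ofReal_norm, hc, Complex.norm_real, Real.norm_of_nonneg ENNReal.toReal_nonneg,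
      ENNReal.ofReal_toReal (ENNReal.inv_ne_top.2 ha0)]
  have hcf : 𝓕 (c • f) = c • 𝓕 f := VectorFourier.fourierIntegral_const_smul _ _ _ f c
  have hA : ∫⁻ x, ‖(c • f) x‖ₑ ^ p ≤ 1 := by
    simp only [Pi.smul_apply, enorm_smul, ENNReal.mul_rpow_of_nonneg _ _ hp0.le]
    rw [lintegral_const_mul _ (by fun_prop), hcn, ha, ← ENNReal.inv_rpow, ← ENNReal.rpow_mul,
      one_div_mul_cancel hp0.ne', ENNReal.rpow_one, ENNReal.inv_mul_cancel h0 hT]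
  have hfin := lintegral_fourier_rpow_le_of_le_one hp2 hpq (hfm.const_smul c) (hf.smul c) hA
  rw [hcf] at hfin
  simp only [Pi.smul_apply, enorm_smul, ENNReal.mul_rpow_of_nonneg _ _ hq0.le] at hfin
  rw [lintegral_const_mul _ ((continuous_fourier_of_integrable hf).enorm.measurable.pow_const _),
    hcn] at hfin
  have h2 := ENNReal.rpow_le_rpow hfin (z := 1 / q) (by positivity)
  rw [ENNReal.mul_rpow_of_nonneg _ _ (by positivity), ← ENNReal.rpow_mul,
    mul_one_div_cancel hq0.ne', ENNReal.rpow_one,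
    ENNReal.inv_mul_le_iff ha0 haT, mul_comm] at h2
  refine h2.trans (mul_le_mul_left ?_ _)
  rw [← hK, ENNReal.coe_rpow_of_nonneg _ (by positivity)]
  refine ENNReal.rpow_le_rpow ?_ (by positivity)
  rw [ENNReal.ofReal]
  exact_mod_cast le_self_add

end HausdorffYoung

/-! ### The Christ-Kiselev lemma and its iteration. -/

section ChristKiselev

variable {X Y : Type*} [MeasurableSpace X] [MeasurableSpace Y]

/-- `M` is a subadditive operator on the functions `f` with `∫ |f| ^ p < ∞`, bounded from `L^p` to
`L^q` with constant `B`. -/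
structure IsSublinearBounded (μ : Measure X) (ν : Measure Y) (p q : ℝ) (B : ℝ≥0)
    (M : (X → ℂ) → Y → ℝ≥0∞) : Prop where
  add_le : ∀ f g, MemLp f (ENNReal.ofReal p) μ → MemLp g (ENNReal.ofReal p) μ →
    ∀ y, M (f + g) y ≤ M f y + M g y
  measurable : ∀ f, MemLp f (ENNReal.ofReal p) μ → Measurable (M f)
  bound : ∀ f, MemLp f (ENNReal.ofReal p) μ →
    (∫⁻ y, M f y ^ q ∂ν) ^ (1 / q) ≤ B * (∫⁻ x, ‖f x‖ₑ ^ p ∂μ) ^ (1 / p)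

/-- The maximal truncation of `M` with respect to the sublevel sets of `φ` at the levels in `S`. -/
noncomputable def maxTrunc (M : (X → ℂ) → Y → ℝ≥0∞) (φ : X → ℝ) (S : Finset ℝ) (f : X → ℂ) (y : Y) :
    ℝ≥0∞ :=
  ⨆ r ∈ S, M ({x | φ x ≤ r}.indicator f) y

variable {μ : Measure X} {ν : Measure Y} {p q : ℝ} {B : ℝ≥0} {M : (X → ℂ) → Y → ℝ≥0∞} {φ : X → ℝ}

theorem lintegral_indicator_enorm_rpow (hp : 0 < p) {s : Set X} (hs : MeasurableSet s) (f : X → ℂ) :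
    ∫⁻ x, ‖s.indicator f x‖ₑ ^ p ∂μ = ∫⁻ x in s, ‖f x‖ₑ ^ p ∂μ := by
  rw [← lintegral_indicator hs]
  refine lintegral_congr fun x => ?_
  by_cases hx : x ∈ s <;> simp [hx, hp]

theorem IsSublinearBounded.measurable_maxTrunc (hM : IsSublinearBounded μ ν p q B M)
    (hφ : Measurable φ) (S : Finset ℝ) {f : X → ℂ} (hf : MemLp f (ENNReal.ofReal p) μ) :
    Measurable (maxTrunc M φ S f) :=
  Measurable.biSup (S : Set ℝ) S.countable_toSet fun _ _ => hM.measurable _ (hf.indicator (hφ measurableSet_Iic))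

/-- Bounding the q-th power of a maximum by the sum of q-th powers costs a factor 2^{1/q} for two
equal norms, instead of the 2 of the triangle inequality. The Christ-Kiselev recursion closes only
because of this saving. -/
theorem lintegral_max_rpow_le (hq : 0 < q) {u v : Y → ℝ≥0∞} (hu : Measurable u) :
    (∫⁻ y, max (u y) (v y) ^ q ∂ν) ^ (1 / q) ≤
      (((∫⁻ y, u y ^ q ∂ν) ^ (1 / q)) ^ q + ((∫⁻ y, v y ^ q ∂ν) ^ (1 / q)) ^ q) ^ (1 / q) := by
  rw [← ENNReal.rpow_mul, ← ENNReal.rpow_mul, one_div_mul_cancel hq.ne', ENNReal.rpow_one,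
    ENNReal.rpow_one, ← lintegral_add_left (hu.pow_const q)]
  refine ENNReal.rpow_le_rpow (lintegral_mono fun y => ?_) (by positivity)
  rcases le_total (u y) (v y) with h | h <;> simp [h]

/-- A level at which the mass of a measure is split into parts of at most half the total. -/
theorem exists_halving_level [IsFiniteMeasure μ] (hφ : Measurable φ) {S : Finset ℝ}
    (hS : S.Nonempty) :
    ∃ k ∈ S, (∀ r ∈ S, r < k → μ {x | φ x ≤ r} ≤ μ Set.univ / 2) ∧
      ((∀ r ∈ S, r ≤ k) ∨ μ {x | φ x ≤ k}ᶜ ≤ μ Set.univ / 2) := by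
  classical
  -- G collects the levels whose sublevel set holds more than half the mass. The splitting level is
  -- the least of them, or the largest level in S if there are none.
  set G : Finset ℝ := S.filter fun r => μ Set.univ / 2 < μ {x | φ x ≤ r} with hG
  have hlow : ∀ r ∈ S, r ∉ G → μ {x | φ x ≤ r} ≤ μ Set.univ / 2 := fun r hr hrG => by
    simpa [hG, hr] using hrG
  rcases G.eq_empty_or_nonempty with h | h
  · exact ⟨S.max' hS, S.max'_mem hS, fun r hr _ => hlow r hr (by simp [h]),
      Or.inl fun r hr => S.le_max' r hr⟩
  · refine ⟨G.min' h, (Finset.mem_filter.1 (G.min'_mem h)).1,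
      fun r hr hlt => hlow r hr fun hrG => (G.min'_le r hrG).not_gt hlt, Or.inr ?_⟩
    have hmem := (Finset.mem_filter.1 (G.min'_mem h)).2
    rw [measure_compl (show MeasurableSet {x | φ x ≤ G.min' h} from hφ measurableSet_Iic)
      (measure_ne_top _ _)]
    refine tsub_le_iff_left.2 ?_
    calc μ Set.univ = μ Set.univ / 2 + μ Set.univ / 2 := (ENNReal.add_halves _).symm
      _ ≤ _ := by gcongr

/-- The Christ-Kiselev lemma. -/
theorem IsSublinearBounded.lintegral_maxTrunc_le (hM : IsSublinearBounded μ ν p q B M)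
    (hφ : Measurable φ) (hp : 0 < p) (hq : 1 ≤ q) {K : ℝ≥0}
    (hK : K * 2 ^ (1 / q - 1 / p) + B ≤ K) (S : Finset ℝ) :
    ∀ f : X → ℂ, MemLp f (ENNReal.ofReal p) μ →
      (∫⁻ y, maxTrunc M φ S f y ^ q ∂ν) ^ (1 / q) ≤ K * (∫⁻ x, ‖f x‖ₑ ^ p ∂μ) ^ (1 / p) := by
  classical
  induction S using Finset.strongInduction with
  | H S ih =>
  intro f hf
  have hq0 : 0 < q := by linarith
  have hms : ∀ r : ℝ, MeasurableSet {x | φ x ≤ r} := fun r => hφ measurableSet_Iic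
  rcases S.eq_empty_or_nonempty with rfl | hS
  · simp [maxTrunc, hq0]
  set A : ℝ≥0∞ := ∫⁻ x, ‖f x‖ₑ ^ p ∂μ with hA
  have hAT : A ≠ ⊤ := by
    have := (eLpNorm_lt_top_iff_lintegral_rpow_enorm_lt_top (p := ENNReal.ofReal p) (by simpa)
      (by simp)).1 hf.2
    rw [ENNReal.toReal_ofReal hp.le] at this
    exact this.ne
  set ρ : Measure X := μ.withDensity fun x => ‖f x‖ₑ ^ p with hρ
  have hρs : ∀ s, MeasurableSet s → ρ s = ∫⁻ x in s, ‖f x‖ₑ ^ p ∂μ := fun s hs =>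
    withDensity_apply _ hs
  have hρA : ρ Set.univ = A := by rw [hρs _ MeasurableSet.univ, Measure.restrict_univ]
  have : IsFiniteMeasure ρ := ⟨by rw [hρA]; exact hAT.lt_top⟩
  obtain ⟨k, hkS, hkL, hkR⟩ := exists_halving_level (μ := ρ) hφ hS
  rw [hρA] at hkL hkR
  set SL := S.filter fun r => r < k
  set SR := S.filter fun r => k < r
  have hSL : SL ⊂ S := Finset.filter_ssubset.2 ⟨k, hkS, lt_irrefl k⟩
  have hSR : SR ⊂ S := Finset.filter_ssubset.2 ⟨k, hkS, lt_irrefl k⟩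
  set fk := {x | φ x ≤ k}.indicator f with hfk
  set fR := {x | φ x ≤ k}ᶜ.indicator f with hfR
  have hfkm : MemLp fk (ENNReal.ofReal p) μ := hf.indicator (hms k)
  have hfRm : MemLp fR (ENNReal.ofReal p) μ := hf.indicator (hms k).compl
  -- Truncations below k see f only up to the largest level m < k, where at most half the mass lies,
  -- so induction applies to f cut at m.
  have hL : (∫⁻ y, maxTrunc M φ SL f y ^ q ∂ν) ^ (1 / q) ≤ K * (A / 2) ^ (1 / p) := by
    rcases SL.eq_empty_or_nonempty with h | h
    · simp [h, maxTrunc, hq0]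
    · set m := SL.max' h
      have hm := Finset.mem_filter.1 (SL.max'_mem h)
      have heq : ∀ y, maxTrunc M φ SL f y = maxTrunc M φ SL ({x | φ x ≤ m}.indicator f) y := by
        intro y
        refine iSup_congr fun r => iSup_congr fun hr => ?_
        rw [Set.indicator_indicator]
        congr 2
        ext x
        exact ⟨fun hx => ⟨hx, le_trans hx (SL.le_max' r hr)⟩, fun hx => hx.1⟩
      simp only [heq]
      refine (ih SL hSL _ (hf.indicator (hms m))).trans ?_
      rw [lintegral_indicator_enorm_rpow hp (hms m), ← hρs _ (hms m)]
      gcongr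
      exact hkL m hm.1 hm.2
  have hR : (∫⁻ y, maxTrunc M φ SR fR y ^ q ∂ν) ^ (1 / q) ≤ K * (A / 2) ^ (1 / p) := by
    rcases hkR with h | h
    · have : SR = ∅ := Finset.filter_eq_empty_iff.2 fun r hr => not_lt.2 (h r hr)
      simp [this, maxTrunc, hq0]
    · refine (ih SR hSR _ hfRm).trans ?_
      rw [lintegral_indicator_enorm_rpow hp (hms k).compl, ← hρs _ (hms k).compl]
      gcongr
  have hMk : (∫⁻ y, M fk y ^ q ∂ν) ^ (1 / q) ≤ B * A ^ (1 / p) := by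
    refine (hM.bound fk hfkm).trans ?_
    rw [lintegral_indicator_enorm_rpow hp (hms k)]
    gcongr
    exact setLIntegral_le_lintegral _ _
  -- A truncation above k is the fixed piece up to k plus a truncation of the remainder. The fixed
  -- piece does not depend on r and is paid for once, by the bound for M.
  have hpt : ∀ y, maxTrunc M φ S f y ≤
      M fk y + max (maxTrunc M φ SL f y) (maxTrunc M φ SR fR y) := by
    intro y
    refine iSup₂_le fun r hr => ?_
    rcases lt_trichotomy r k with h | h | h
    · refine le_add_left (le_max_of_le_left ?_)
      exact le_iSup₂_of_le r (Finset.mem_filter.2 ⟨hr, h⟩) le_rfl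
    · subst h; exact le_add_right le_rfl
    · have hdec : {x | φ x ≤ r}.indicator f = fk + {x | φ x ≤ r}.indicator fR := by
        ext x
        by_cases h1 : φ x ≤ k
        · simp [hfk, hfR, Set.indicator, h1, h1.trans h.le]
        · simp [hfk, hfR, Set.indicator, h1]
      rw [hdec]
      refine (hM.add_le _ _ hfkm (hfRm.indicator (hms r)) y).trans ?_
      gcongr
      refine le_max_of_le_right ?_
      exact le_iSup₂_of_le (f := fun r _ => M ({x | φ x ≤ r}.indicator fR) y) r
        (Finset.mem_filter.2 ⟨hr, h⟩) le_rfl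
  have hmL := hM.measurable_maxTrunc hφ SL hf
  have hmR := hM.measurable_maxTrunc hφ SR hfRm
  calc (∫⁻ y, maxTrunc M φ S f y ^ q ∂ν) ^ (1 / q)
      ≤ (∫⁻ y, (M fk + fun y => max (maxTrunc M φ SL f y) (maxTrunc M φ SR fR y)) y ^ q ∂ν) ^
          (1 / q) := by
        refine ENNReal.rpow_le_rpow (lintegral_mono fun y => ?_) (by positivity)
        exact ENNReal.rpow_le_rpow (hpt y) hq0.le
    _ ≤ _ := ENNReal.lintegral_Lp_add_le (hM.measurable _ hfkm).aemeasurable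
        (hmL.max hmR).aemeasurable hq
    _ ≤ B * A ^ (1 / p) + ((K * (A / 2) ^ (1 / p)) ^ q + (K * (A / 2) ^ (1 / p)) ^ q) ^ (1 / q) := by
        refine add_le_add hMk ((lintegral_max_rpow_le hq0 hmL).trans ?_)
        gcongr
    _ = (K * 2 ^ (1 / q - 1 / p) + B : ℝ≥0) * A ^ (1 / p) := by
        -- Here 2^{1/q} comes from taking the maximum of two terms and 2^{-1/p} from the halved
        -- mass.
        have h2 : (2 : ℝ≥0∞) ^ (1 / q - 1 / p) = 2 ^ (1 / q) * (2⁻¹) ^ (1 / p) := by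
          rw [ENNReal.rpow_sub _ _ (by norm_num) (by norm_num), ENNReal.inv_rpow]; rfl
        rw [← two_mul, ENNReal.mul_rpow_of_nonneg _ _ (by positivity), ← ENNReal.rpow_mul,
          mul_one_div_cancel hq0.ne', ENNReal.rpow_one, div_eq_mul_inv A,
          ENNReal.mul_rpow_of_nonneg _ _ (by positivity)]
        push_cast
        rw [ENNReal.coe_rpow_of_ne_zero (by norm_num)]
        push_cast
        rw [h2]; ring
    _ ≤ K * A ^ (1 / p) := by gcongr

/-- The class of sublinear bounded operators is closed under maximal truncation; this is what
permits iteration over several parameters. -/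
theorem IsSublinearBounded.maxTrunc (hM : IsSublinearBounded μ ν p q B M)
    (hφ : Measurable φ) (hp : 0 < p) (hq : 1 ≤ q) {K : ℝ≥0}
    (hK : K * 2 ^ (1 / q - 1 / p) + B ≤ K) (S : Finset ℝ) :
    IsSublinearBounded μ ν p q K (maxTrunc M φ S) where
  add_le f g hf hg y := by
    refine iSup₂_le fun r hr => ?_
    rw [Set.indicator_add']
    have hms : MeasurableSet {x | φ x ≤ r} := hφ measurableSet_Iic
    exact (hM.add_le _ _ (hf.indicator hms) (hg.indicator hms) y).trans
      (add_le_add (le_iSup₂_of_le r hr le_rfl) (le_iSup₂_of_le r hr le_rfl))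
  measurable f hf := hM.measurable_maxTrunc hφ S hf
  bound := hM.lintegral_maxTrunc_le hφ hp hq hK S

/-- K = B / (1 - θ) with θ = 2^{1/q - 1/p} solves the recursion with equality; p < q is equivalent
to θ < 1. -/
theorem exists_christKiselev_const (hp : 0 < p) (hpq : p < q) (B : ℝ≥0) :
    ∃ K : ℝ≥0, K * 2 ^ (1 / q - 1 / p) + B ≤ K := by
  have hθ : (2 : ℝ) ^ (1 / q - 1 / p) < 1 :=
    Real.rpow_lt_one_of_one_lt_of_neg (by norm_num) (by
      have := one_div_lt_one_div_of_lt hp hpq; linarith)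
  have hnn : 0 ≤ (B : ℝ) / (1 - 2 ^ (1 / q - 1 / p)) := div_nonneg B.coe_nonneg (by linarith)
  refine ⟨Real.toNNReal (B / (1 - 2 ^ (1 / q - 1 / p))), ?_⟩
  rw [← NNReal.coe_le_coe]
  push_cast
  rw [Real.coe_toNNReal _ hnn]
  have : (1 : ℝ) - 2 ^ (1 / q - 1 / p) ≠ 0 := by linarith
  refine le_of_eq ?_
  generalize (2 : ℝ) ^ (1 / q - 1 / p) = θ at this
  field_simp
  ring

/-- Multi-parameter maximal truncations, with a constant independent of the set of levels. -/
theorem exists_multiparameter_maximal {ι : Type*} {φ : ι → X → ℝ} (hφ : ∀ i, Measurable (φ i))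
    (hp : 0 < p) (hpq : p < q) (hq : 1 ≤ q) (B : ℝ≥0) (J : Finset ι) :
    ∃ K : ℝ≥0, ∀ M : (X → ℂ) → Y → ℝ≥0∞, IsSublinearBounded μ ν p q B M → ∀ S : Finset ℝ,
      ∃ M' : (X → ℂ) → Y → ℝ≥0∞, IsSublinearBounded μ ν p q K M' ∧
        ∀ f : X → ℂ, ∀ R : ι → ℝ, (∀ i ∈ J, R i ∈ S) →
          ∀ y, M ({x | ∀ i ∈ J, φ i x ≤ R i}.indicator f) y ≤ M' f y := by
  classical
  induction J using Finset.induction_on with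
  | empty => exact ⟨B, fun M hM S => ⟨M, hM, fun f R _ y => by simp⟩⟩
  | insert a J _ ih =>
    obtain ⟨K, hK⟩ := ih
    obtain ⟨K', hK'⟩ := exists_christKiselev_const hp hpq K
    refine ⟨K', fun M hM S => ?_⟩
    obtain ⟨M', hM', hMM'⟩ := hK M hM S
    refine ⟨_, hM'.maxTrunc (hφ a) hp hq hK' S, fun f R hR y => ?_⟩
    -- The truncation in the new parameter is absorbed into the function, so the operator already
    -- maximal over J is applied to a truncated f.
    have hset : {x | ∀ i ∈ insert a J, φ i x ≤ R i}.indicator f =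
        {x | ∀ i ∈ J, φ i x ≤ R i}.indicator ({x | φ a x ≤ R a}.indicator f) := by
      rw [Set.indicator_indicator]
      congr 1
      ext x
      simp [and_comm]
    rw [hset]
    refine (hMM' _ R (fun i hi => hR i (Finset.mem_insert_of_mem hi)) y).trans ?_
    exact le_iSup₂_of_le (f := fun r _ => M' ({x | φ a x ≤ r}.indicator f) y) (R a)
      (hR a (Finset.mem_insert_self _ _)) le_rfl

end ChristKiselev

/-! ### Truncation to boxes and the maximal estimate. -/

section RectangularSums

variable {d : ℕ}

theorem isCompact_centeredBox (R : Fin d → ℝ) : IsCompact (centeredBox R) := by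
  have h := (EuclideanSpace.equiv (Fin d) ℝ).toHomeomorph.isCompact_preimage.2
    (isCompact_univ_pi fun j => isCompact_Icc (a := -R j) (b := R j))
  convert h using 1
  ext x
  simp only [centeredBox, Set.mem_preimage, Set.mem_univ_pi]
  rfl

theorem integrable_indicator_centeredBox {p : ℝ≥0∞} (hp : 1 ≤ p)
    {f : EuclideanSpace ℝ (Fin d) → ℂ} (hf : MemLp f p volume) (R : Fin d → ℝ) :
    Integrable ((centeredBox R).indicator f) :=
  (integrable_indicator_iff (measurableSet_centeredBox R)).2
    ((hf.locallyIntegrable hp).integrableOn_isCompact (isCompact_centeredBox R))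

/-- Truncations to bounded boxes are integrable, so their transforms are continuous; lower
semicontinuity survives the uncountable supremum and supplies measurability. -/
theorem lowerSemicontinuous_maximalRectFourier {p : ℝ≥0∞} (hp : 1 ≤ p)
    {f : EuclideanSpace ℝ (Fin d) → ℂ} (hf : MemLp f p volume) :
    LowerSemicontinuous (maximalRectFourier f) :=
  lowerSemicontinuous_biSup fun R _ =>
    (continuous_fourier_of_integrable (integrable_indicator_centeredBox hp hf R)).enorm
      |>.lowerSemicontinuous

theorem measurable_maximalRectFourier {p : ℝ≥0∞} (hp : 1 ≤ p)
    {f : EuclideanSpace ℝ (Fin d) → ℂ} (hf : MemLp f p volume) :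
    Measurable (maximalRectFourier f) :=
  (lowerSemicontinuous_maximalRectFourier hp hf).measurable

/-- Lets dominated convergence be used along independent radii tending to infinity. -/
instance isCountablyGenerated_atTop_pi_real :
    (atTop : Filter (Fin d → ℝ)).IsCountablyGenerated := by
  have h : (atTop : Filter (Fin d → ℝ)).HasBasis (fun _ : ℕ => True)
      (fun n => Set.Ici fun _ => (n : ℝ)) := by
    refine atTop_basis.to_hasBasis (fun R _ => ?_) fun n _ => ⟨_, trivial, subset_rfl⟩
    obtain ⟨n, hn⟩ := exists_nat_ge (∑ j, |R j|)
    refine ⟨n, trivial, Set.Ici_subset_Ici.2 fun j => ?_⟩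
    exact ((le_abs_self _).trans (Finset.single_le_sum (f := fun j => |R j|)
      (fun i _ => abs_nonneg _) (Finset.mem_univ j))).trans hn
  exact h.isCountablyGenerated

theorem fourier_tendsto_of_tendsto_indicator {α : Type*} {l : Filter α} [l.IsCountablyGenerated]
    {V : Type*} [NormedAddCommGroup V] [InnerProductSpace ℝ V] [FiniteDimensional ℝ V]
    [MeasurableSpace V] [BorelSpace V] {f g h : V → ℂ} (hg : Integrable g) {s : α → Set V}
    (hf : AEStronglyMeasurable f volume)
    (hs : ∀ a, MeasurableSet (s a)) (hle : ∀ᶠ a in l, ∀ x, ‖(s a).indicator f x‖ ≤ ‖g x‖)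
    (hlim : ∀ x, ∀ᶠ a in l, (s a).indicator f x = h x) (ξ : V) :
    Tendsto (fun a => 𝓕 ((s a).indicator f) ξ) l (𝓝 (𝓕 h ξ)) := by
  simp only [Real.fourier_eq]
  refine tendsto_integral_filter_of_dominated_convergence (fun x => ‖g x‖)
    (Eventually.of_forall fun a => ?_) ?_ hg.norm (Eventually.of_forall fun x => ?_)
  · refine AEStronglyMeasurable.smul (Continuous.aestronglyMeasurable ?_) (hf.indicator (hs a))
    fun_prop
  · filter_upwards [hle] with a ha
    exact Eventually.of_forall fun x => by simpa using ha x
  · refine tendsto_const_nhds.congr' ?_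
    filter_upwards [hlim x] with a ha
    rw [ha]

/-- The maximal function is the supremum over rational rectangles. -/
theorem maximalRectFourier_le_iSup_rat {p : ℝ≥0∞} (hp : 1 ≤ p)
    {f : EuclideanSpace ℝ (Fin d) → ℂ} (hf : MemLp f p volume) (ξ : EuclideanSpace ℝ (Fin d)) :
    maximalRectFourier f ξ ≤
      ⨆ r : Fin d → ℚ, ‖𝓕 ((centeredBox fun j => (r j : ℝ)).indicator f) ξ‖ₑ := by
  refine iSup₂_le fun R _ => ?_
  -- The boxes are closed, so approximation from outside makes the indicators converge at every
  -- point, boundary included.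
  have hr : ∀ n : ℕ, ∃ r : Fin d → ℚ, ∀ j, R j < r j ∧ (r j : ℝ) < R j + 1 / ((n : ℝ) + 1) := by
    intro n
    choose r hr using fun j => exists_rat_btwn
      (show R j < R j + 1 / ((n : ℝ) + 1) from lt_add_of_pos_right _ (by positivity))
    exact ⟨r, hr⟩
  choose r hr using hr
  have hlim : Tendsto (fun n => 𝓕 ((centeredBox fun j => (r n j : ℝ)).indicator f) ξ) atTop
      (𝓝 (𝓕 ((centeredBox R).indicator f) ξ)) := by
    refine fourier_tendsto_of_tendsto_indicator
      (integrable_indicator_centeredBox hp hf fun j => R j + 1) hf.1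
      (fun n => measurableSet_centeredBox _) (Eventually.of_forall fun n x => ?_) (fun x => ?_) ξ
    · have hsub : centeredBox (fun j => (r n j : ℝ)) ⊆ centeredBox fun j => R j + 1 := by
        intro x hx j
        have h1 : 1 / ((n : ℝ) + 1) ≤ 1 := by
          rw [div_le_one (by positivity)]; linarith [n.cast_nonneg (α := ℝ)]
        have h2 := (hr n j).2
        have h3 := hx j
        exact ⟨by linarith [h3.1], by linarith [h3.2]⟩
      exact norm_indicator_le_of_subset hsub f x
    · by_cases hx : x ∈ centeredBox R
      · refine Eventually.of_forall fun n => ?_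
        rw [Set.indicator_of_mem hx, Set.indicator_of_mem]
        exact fun j => ⟨by linarith [(hx j).1, (hr n j).1], by linarith [(hx j).2, (hr n j).1]⟩
      · have hx' : ∃ j, R j < |x j| := by
          by_contra! hcon
          exact hx fun j => abs_le.1 (hcon j)
        obtain ⟨j, hj⟩ := hx'
        have hev : ∀ᶠ n : ℕ in atTop, R j + 1 / ((n : ℝ) + 1) < |x j| := by
          have : Tendsto (fun n : ℕ => R j + 1 / ((n : ℝ) + 1)) atTop (𝓝 (R j + 0)) :=
            tendsto_one_div_add_atTop_nhds_zero_nat.const_add _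
          rw [add_zero] at this
          exact this.eventually (gt_mem_nhds hj)
        filter_upwards [hev] with n hn
        rw [Set.indicator_of_notMem hx, Set.indicator_of_notMem]
        intro hmem
        have := abs_le.2 (hmem j)
        linarith [(hr n j).2]
  exact le_of_tendsto hlim.enorm (Eventually.of_forall fun n =>
    le_iSup (fun r : Fin d → ℚ => ‖𝓕 ((centeredBox fun j => (r j : ℝ)).indicator f) ξ‖ₑ) (r n))

theorem tendsto_rectFourierIntegral_of_integrable {f : EuclideanSpace ℝ (Fin d) → ℂ}
    (hf : Integrable f) (ξ : EuclideanSpace ℝ (Fin d)) :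
    Tendsto (fun R : Fin d → ℝ => rectFourierIntegral f R ξ) atTop (𝓝 (𝓕 f ξ)) := by
  simp only [← fourier_indicator_centeredBox]
  refine fourier_tendsto_of_tendsto_indicator hf hf.1
    (fun R => measurableSet_centeredBox R)
    (Eventually.of_forall fun R x => norm_indicator_le_norm_self _ _) (fun x => ?_) ξ
  filter_upwards [eventually_ge_atTop fun j => |x j|] with R hR
  have hx : x ∈ centeredBox R := fun j => abs_le.1 (hR j)
  exact Set.indicator_of_mem hx f

/-- The maximal estimate for `1 < p < 2`. -/
theorem exists_lintegral_maximalRectFourier_le {p q : ℝ} (hp2 : p < 2)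
    (hpq : p.HolderConjugate q) :
    ∃ C : ℝ≥0, ∀ f : EuclideanSpace ℝ (Fin d) → ℂ, MemLp f (ENNReal.ofReal p) volume →
      (∫⁻ ξ, maximalRectFourier f ξ ^ q) ^ (1 / q) ≤ C * (∫⁻ x, ‖f x‖ₑ ^ p) ^ (1 / p) := by
  have hp0 : 0 < p := hpq.pos
  have hq0 : 0 < q := hpq.symm.pos
  have hp1 : 1 < p := hpq.lt
  have hq1 : 1 < q := hpq.symm.lt
  have hlt : p < q := by nlinarith [hpq.mul_eq_add]
  have hp1' : 1 ≤ ENNReal.ofReal p := by simpa using hp1.le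
  obtain ⟨B, hB⟩ := exists_lintegral_fourier_rpow_le (V := EuclideanSpace ℝ (Fin d)) hp2 hpq
  obtain ⟨K, hK⟩ := exists_multiparameter_maximal (X := EuclideanSpace ℝ (Fin d))
    (Y := EuclideanSpace ℝ (Fin d)) (μ := volume) (ν := volume)
    (φ := fun (j : Fin d) x => |x j|) (fun j => by fun_prop) hp0 hlt hq1.le B Finset.univ
  -- A function in L^p need not be integrable, so the Fourier integral is preceded by a cutoff to a
  -- cube. The bound B does not depend on the size of the cube.
  have hbase : ∀ N : ℝ, IsSublinearBounded volume volume p q B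
      fun f (ξ : EuclideanSpace ℝ (Fin d)) =>
        ‖𝓕 ((centeredBox fun _ => N).indicator f) ξ‖ₑ := fun N =>
    { add_le := fun f g hf hg ξ => by
        rw [Set.indicator_add', fourier_add_of_integrable
          (integrable_indicator_centeredBox hp1' hf _) (integrable_indicator_centeredBox hp1' hg _)]
        exact enorm_add_le _ _
      measurable := fun f hf => (continuous_fourier_of_integrable
        (integrable_indicator_centeredBox hp1' hf _)).enorm.measurable
      bound := fun f hf => by
        refine (hB _ (integrable_indicator_centeredBox hp1' hf _)).trans ?_
        gcongr
        exact enorm_indicator_le_enorm_self _ _ }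
  refine ⟨K, fun f hf => ?_⟩
  obtain ⟨u, hu⟩ := exists_surjective_nat (Fin d → ℚ)
  set h : ℕ → EuclideanSpace ℝ (Fin d) → ℝ≥0∞ := fun k ξ =>
    ‖𝓕 ((centeredBox fun j => (u k j : ℝ)).indicator f) ξ‖ₑ with hh
  have hhm : ∀ k, Measurable (h k) := fun k => (continuous_fourier_of_integrable
    (integrable_indicator_centeredBox hp1' hf _)).enorm.measurable
  have hfin : ∀ n, (∫⁻ ξ, (⨆ k ∈ Finset.range n, h k ξ) ^ q) ^ (1 / q) ≤
      K * (∫⁻ x, ‖f x‖ₑ ^ p) ^ (1 / p) := by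
    intro n
    classical
    set S : Finset ℝ := (Finset.range n).biUnion fun k => Finset.univ.image fun j => (u k j : ℝ)
      with hS
    have hSmem : ∀ k ∈ Finset.range n, ∀ j, (u k j : ℝ) ∈ S := fun k hk j =>
      Finset.mem_biUnion.2 ⟨k, hk, Finset.mem_image_of_mem _ (Finset.mem_univ j)⟩
    -- A cube containing every box under consideration makes the cutoff invisible.
    obtain ⟨N, hN⟩ := S.bddAbove
    obtain ⟨M', hM', hle⟩ := hK _ (hbase N) S
    refine le_trans ?_ (hM'.bound f hf)
    gcongr with ξ
    refine iSup₂_le fun k hk => ?_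
    have h1 := hle f (fun j => (u k j : ℝ)) (fun j _ => hSmem k hk j) ξ
    rw [Set.indicator_indicator] at h1
    have hset : centeredBox (fun _ => N) ∩
        {x : EuclideanSpace ℝ (Fin d) | ∀ j ∈ Finset.univ, |x j| ≤ (u k j : ℝ)} =
        centeredBox fun j => (u k j : ℝ) := by
      ext x
      constructor
      · rintro ⟨_, hx⟩ j
        exact abs_le.1 (hx j (Finset.mem_univ j))
      · refine fun hx => ⟨fun j => ?_, fun j _ => abs_le.2 (hx j)⟩
        exact abs_le.1 ((abs_le.2 (hx j)).trans (hN (hSmem k hk j)))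
    rw [hset] at h1
    exact h1
  have hsup : ∀ ξ, maximalRectFourier f ξ ≤ ⨆ n : ℕ, ⨆ k ∈ Finset.range n, h k ξ := by
    intro ξ
    refine (maximalRectFourier_le_iSup_rat hp1' hf ξ).trans (iSup_le fun r => ?_)
    obtain ⟨k, rfl⟩ := hu r
    exact le_iSup_of_le (k + 1) (le_iSup₂_of_le (f := fun k _ => h k ξ) k (by simp) le_rfl)
  have hmono : Monotone fun n ξ => (⨆ k ∈ Finset.range n, h k ξ) ^ q := by
    intro m n hmn ξ
    refine ENNReal.rpow_le_rpow ?_ hq0.le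
    exact biSup_mono fun k hk => Finset.range_mono hmn hk
  have hint : ∫⁻ ξ, maximalRectFourier f ξ ^ q ≤ ⨆ n, ∫⁻ ξ, (⨆ k ∈ Finset.range n, h k ξ) ^ q := by
    have hm : ∀ n, Measurable fun ξ => (⨆ k ∈ Finset.range n, h k ξ) ^ q := fun n =>
      (Measurable.biSup (Finset.range n : Set ℕ) (Finset.countable_toSet _)
        fun k _ => hhm k).pow_const q
    rw [← lintegral_iSup hm hmono]
    refine lintegral_mono fun ξ => ?_
    refine (ENNReal.rpow_le_rpow (hsup ξ) hq0.le).trans ?_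
    exact ((ENNReal.orderIsoRpow q hq0).map_iSup fun n => ⨆ k ∈ Finset.range n, h k ξ).le
  rw [one_div, ENNReal.rpow_inv_le_iff hq0]
  refine hint.trans (iSup_le fun n => ?_)
  rw [← ENNReal.rpow_inv_le_iff hq0, ← one_div]
  exact hfin n

theorem maximalRectFourier_le_eLpNorm_one (f : EuclideanSpace ℝ (Fin d) → ℂ)
    (ξ : EuclideanSpace ℝ (Fin d)) : maximalRectFourier f ξ ≤ eLpNorm f 1 volume :=
  iSup₂_le fun _ _ => (enorm_fourier_le_eLpNorm_one _ ξ).trans (eLpNorm_indicator_le _)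

theorem exists_eLpNorm_maximalRectFourier_le {p q : ℝ≥0∞} (hp1 : 1 ≤ p) (hp2 : p < 2)
    (hpq : ENNReal.HolderConjugate p q) :
    ∃ C : ℝ≥0, ∀ f : EuclideanSpace ℝ (Fin d) → ℂ, MemLp f p volume →
      eLpNorm (maximalRectFourier f) q volume ≤ C * eLpNorm f p volume := by
  rcases hp1.eq_or_lt with rfl | hp1
  · refine ⟨1, fun f hf => ?_⟩
    have hq : q = ⊤ := by
      have := hpq.inv_add_inv_eq_one
      simpa using this
    rw [hq, eLpNorm_exponent_top, ENNReal.coe_one, one_mul]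
    exact eLpNormEssSup_le_of_ae_enorm_bound (Eventually.of_forall fun ξ => by
      simpa using maximalRectFourier_le_eLpNorm_one f ξ)
  · have hpT : p ≠ ⊤ := (hp2.trans (by norm_num)).ne
    have hp1r : 1 < p.toReal := by
      simpa using (ENNReal.toReal_lt_toReal (by norm_num) hpT).2 hp1
    have hp2r : p.toReal < 2 := by
      simpa using (ENNReal.toReal_lt_toReal hpT (by norm_num)).2 hp2
    have hpqr := ENNReal.HolderConjugate.toReal (q := q) hp1r
    have hqpos := hpqr.symm.pos
    have hq0 : q ≠ 0 := fun h => by simp [h] at hqpos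
    have hqT : q ≠ ⊤ := fun h => by simp [h] at hqpos
    obtain ⟨C, hC⟩ := exists_lintegral_maximalRectFourier_le (d := d) hp2r hpqr
    refine ⟨C, fun f hf => ?_⟩
    rw [eLpNorm_eq_lintegral_rpow_enorm_toReal hq0 hqT,
      eLpNorm_eq_lintegral_rpow_enorm_toReal (by positivity) hpT]
    simpa using hC f (by rwa [ENNReal.ofReal_toReal hpT])

end RectangularSums

/-! ### The Fourier extension and almost everywhere convergence. -/

section Convergence

variable {d : ℕ} {p q : ℝ≥0∞} [Fact (1 ≤ p)] [Fact (1 ≤ q)]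

/-- Through this domination, the maximal estimate alone yields the L^p to L^q bound on Schwartz
functions that defines the extension. -/
theorem enorm_fourier_le_maximalRectFourier {f : EuclideanSpace ℝ (Fin d) → ℂ} (hf : Integrable f)
    (ξ : EuclideanSpace ℝ (Fin d)) : ‖𝓕 f ξ‖ₑ ≤ maximalRectFourier f ξ := by
  refine le_of_tendsto (tendsto_rectFourierIntegral_of_integrable hf ξ).enorm ?_
  filter_upwards [eventually_ge_atTop fun _ => (1 : ℝ)] with R hR
  rw [← fourier_indicator_centeredBox]
  exact le_iSup₂_of_le (f := fun R _ => ‖𝓕 ((centeredBox R).indicator f) ξ‖ₑ) R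
    (fun j => zero_lt_one.trans_le (hR j)) le_rfl

/-- A bound for the maximal function gives the Fourier extension `L^p → L^q`. -/
theorem exists_isFourierExtension (hp : p ≠ ⊤) {C : ℝ≥0}
    (hC : ∀ f : EuclideanSpace ℝ (Fin d) → ℂ, MemLp f p volume →
      eLpNorm (maximalRectFourier f) q volume ≤ C * eLpNorm f p volume) :
    ∃ T : Lp (α := EuclideanSpace ℝ (Fin d)) ℂ p volume →L[ℂ]
      Lp (α := EuclideanSpace ℝ (Fin d)) ℂ q volume, IsFourierExtension T := by
  let e : 𝓢(EuclideanSpace ℝ (Fin d), ℂ) →ₗ[ℂ] Lp (α := EuclideanSpace ℝ (Fin d)) ℂ p volume :=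
    (SchwartzMap.toLpCLM ℂ ℂ p volume).toLinearMap
  let F : 𝓢(EuclideanSpace ℝ (Fin d), ℂ) →ₗ[ℂ] Lp (α := EuclideanSpace ℝ (Fin d)) ℂ q volume :=
    (SchwartzMap.toLpCLM ℂ ℂ q volume).toLinearMap ∘ₗ
      (FourierTransform.fourierCLM ℂ 𝓢(EuclideanSpace ℝ (Fin d), ℂ)).toLinearMap
  have he : ∀ φ, e φ = φ.toLp p volume := fun φ => rfl
  have hF : ∀ φ, F φ = (𝓕 φ).toLp q volume := fun φ => rfl
  have hd : DenseRange e := SchwartzMap.denseRange_toLpCLM hp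
  refine ⟨F.extendOfNorm e, fun φ => ?_⟩
  rw [← he, ← hF]
  refine LinearMap.extendOfNorm_eq hd ⟨C, fun φ => ?_⟩ φ
  rw [he, hF, Lp.norm_def, Lp.norm_def, eLpNorm_congr_ae (SchwartzMap.coeFn_toLp _ _ _),
    eLpNorm_congr_ae (SchwartzMap.coeFn_toLp _ _ _), ← ENNReal.coe_toReal C, ← ENNReal.toReal_mul]
  refine ENNReal.toReal_mono (ENNReal.mul_ne_top ENNReal.coe_ne_top (φ.memLp p volume).2.ne) ?_
  refine le_trans (eLpNorm_mono_enorm fun ξ => ?_) (hC φ (φ.memLp p volume))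
  rw [SchwartzMap.fourier_coe]
  exact enorm_fourier_le_maximalRectFourier (φ.integrable (μ := volume)) ξ

theorem rectFourierIntegral_sub {f g : EuclideanSpace ℝ (Fin d) → ℂ} (hf : MemLp f p volume)
    (hg : MemLp g p volume) (R : Fin d → ℝ) (ξ : EuclideanSpace ℝ (Fin d)) :
    rectFourierIntegral f R ξ = rectFourierIntegral (f - g) R ξ + rectFourierIntegral g R ξ := by
  have hp : 1 ≤ p := Fact.out
  simp only [← fourier_indicator_centeredBox]
  rw [← Pi.add_apply, ← fourier_add_of_integrable
    (integrable_indicator_centeredBox hp (hf.sub hg) R) (integrable_indicator_centeredBox hp hg R),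
    ← Set.indicator_add', sub_add_cancel]

theorem enorm_rectFourierIntegral_le {f : EuclideanSpace ℝ (Fin d) → ℂ} {R : Fin d → ℝ}
    (hR : ∀ j, 0 < R j) (ξ : EuclideanSpace ℝ (Fin d)) :
    ‖rectFourierIntegral f R ξ‖ₑ ≤ maximalRectFourier f ξ := by
  rw [← fourier_indicator_centeredBox]
  exact le_iSup₂_of_le (f := fun R _ => ‖𝓕 ((centeredBox R).indicator f) ξ‖ₑ) R hR le_rfl

/-- Almost everywhere convergence from the maximal estimate. -/
theorem IsFourierExtension.ae_tendsto_rectFourierIntegral (hp : p ≠ ⊤) {C : ℝ≥0}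
    (hC : ∀ f : EuclideanSpace ℝ (Fin d) → ℂ, MemLp f p volume →
      eLpNorm (maximalRectFourier f) q volume ≤ C * eLpNorm f p volume)
    {T : Lp (α := EuclideanSpace ℝ (Fin d)) ℂ p volume →L[ℂ]
      Lp (α := EuclideanSpace ℝ (Fin d)) ℂ q volume} (hT : IsFourierExtension T)
    {f : EuclideanSpace ℝ (Fin d) → ℂ} (hf : MemLp f p volume) :
    ∀ᵐ ξ ∂(volume : Measure (EuclideanSpace ℝ (Fin d))),
      Tendsto (fun R : Fin d → ℝ => rectFourierIntegral f R ξ) atTop (𝓝 (T (hf.toLp f) ξ)) := by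
  have hp1 : 1 ≤ p := Fact.out
  have hq1 : 1 ≤ q := Fact.out
  have hd : DenseRange (SchwartzMap.toLpCLM ℂ (E := EuclideanSpace ℝ (Fin d)) ℂ p volume) :=
    SchwartzMap.denseRange_toLpCLM hp
  have happrox : ∀ n : ℕ, ∃ φ : 𝓢(EuclideanSpace ℝ (Fin d), ℂ),
      ‖hf.toLp f - φ.toLp p volume‖ₑ ≤ (n : ℝ≥0∞)⁻¹ := by
    intro n
    obtain ⟨φ, hφ⟩ := hd.exists_mem_open (Metric.isOpen_eball (x := hf.toLp f)
      (ε := (n : ℝ≥0∞)⁻¹)) ⟨_, Metric.mem_eball_self (by simp)⟩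
    refine ⟨φ, ?_⟩
    rw [Metric.mem_eball, edist_comm, edist_eq_enorm_sub] at hφ
    exact hφ.le
  choose φ hφ using happrox
  have hφm : ∀ n, MemLp (φ n) p volume := fun n => (φ n).memLp p volume
  -- For each n, h n bounds the eventual error of the partial integrals up to a term vanishing as R
  -- → ∞: it adds the maximal function of f - φ n and the difference of the two transforms.
  set h : ℕ → EuclideanSpace ℝ (Fin d) → ℝ≥0∞ := fun n =>
    (maximalRectFourier (f - ⇑(φ n))) + fun ξ => ‖(T ((φ n).toLp p volume) - T (hf.toLp f)) ξ‖ₑ with hh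
  have hhm : ∀ n, AEMeasurable (h n) volume := fun n =>
    (measurable_maximalRectFourier hp1 (hf.sub (hφm n))).aemeasurable.add
      (Lp.aestronglyMeasurable _).enorm
  have hnorm : ∀ n, eLpNorm (h n) q volume ≤ (C + ‖T‖ₑ) * (n : ℝ≥0∞)⁻¹ := by
    intro n
    refine (eLpNorm_add_le (measurable_maximalRectFourier hp1 (hf.sub (hφm n))).aestronglyMeasurable
      (Lp.aestronglyMeasurable _).enorm.aestronglyMeasurable hq1).trans ?_
    rw [add_mul]
    refine add_le_add ((hC _ (hf.sub (hφm n))).trans ?_) ?_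
    · gcongr
      refine le_trans (le_of_eq ?_) (hφ n)
      rw [Lp.enorm_def]
      refine eLpNorm_congr_ae ?_
      filter_upwards [Lp.coeFn_sub (hf.toLp f) ((φ n).toLp p volume), hf.coeFn_toLp,
        (φ n).coeFn_toLp p volume] with x h1 h2 h3
      rw [h1, Pi.sub_apply, Pi.sub_apply, h2, h3]
    · rw [eLpNorm_enorm, ← Lp.enorm_def, ← map_sub]
      refine (T.le_opENorm _).trans ?_
      gcongr
      rw [enorm_sub_rev]
      exact hφ n
  -- Only the infimum over n has to vanish almost everywhere, so convergence of norms suffices and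
  -- no subsequence is extracted.
  have hinf : eLpNorm (fun ξ => ⨅ n, h n ξ) q volume = 0 := by
    have hlim : Tendsto (fun n : ℕ => (C + ‖T‖ₑ) * (n : ℝ≥0∞)⁻¹) atTop (𝓝 ((C + ‖T‖ₑ) * 0)) :=
      ENNReal.Tendsto.const_mul ENNReal.tendsto_inv_nat_nhds_zero (Or.inr (by simp))
    rw [mul_zero] at hlim
    refine le_antisymm (ge_of_tendsto hlim (Eventually.of_forall fun n => ?_)) bot_le
    refine le_trans (eLpNorm_mono_enorm fun ξ => ?_) (hnorm n)
    exact iInf_le _ n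
  have hzero := (eLpNorm_eq_zero_iff (AEMeasurable.iInf hhm).aestronglyMeasurable
    (by positivity)).1 hinf
  have hTφ : ∀ᵐ ξ, ∀ n, (T ((φ n).toLp p volume) - T (hf.toLp f)) ξ =
      𝓕 (⇑(φ n)) ξ - T (hf.toLp f) ξ := by
    refine ae_all_iff.2 fun n => ?_
    rw [hT]
    filter_upwards [Lp.coeFn_sub ((𝓕 (φ n)).toLp q volume) (T (hf.toLp f)),
      (𝓕 (φ n)).coeFn_toLp q volume] with ξ h1 h2
    rw [h1, Pi.sub_apply, h2, SchwartzMap.fourier_coe]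
  filter_upwards [hzero, hTφ] with ξ hξ hTξ
  rw [EMetric.tendsto_nhds]
  intro ε hε
  have hε2 : 0 < ε / 2 := ENNReal.half_pos hε.ne'
  obtain ⟨n, hn⟩ : ∃ n, h n ξ < ε / 2 := by
    refine iInf_lt_iff.1 ?_
    have : ⨅ n, h n ξ = 0 := hξ
    rwa [this]
  have hlim := EMetric.tendsto_nhds.1 (tendsto_rectFourierIntegral_of_integrable
    ((φ n).integrable (μ := volume)) ξ) (ε / 2) hε2
  filter_upwards [hlim, eventually_ge_atTop fun _ => (1 : ℝ)] with R hR1 hR2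
  rw [rectFourierIntegral_sub hf (hφm n)]
  rw [edist_eq_enorm_sub] at hR1 ⊢
  have hpos : ∀ j, 0 < R j := fun j => zero_lt_one.trans_le (hR2 j)
  have hb := enorm_rectFourierIntegral_le (f := f - ⇑(φ n)) hpos ξ
  calc ‖rectFourierIntegral (f - ⇑(φ n)) R ξ + rectFourierIntegral (φ n) R ξ - T (hf.toLp f) ξ‖ₑ
      = ‖(rectFourierIntegral (f - ⇑(φ n)) R ξ + (𝓕 (⇑(φ n)) ξ -
          T (hf.toLp f) ξ)) + (rectFourierIntegral (φ n) R ξ - 𝓕 (⇑(φ n)) ξ)‖ₑ := by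
        congr 1; ring
    _ ≤ (maximalRectFourier (f - ⇑(φ n)) ξ + ‖𝓕 (⇑(φ n)) ξ -
          T (hf.toLp f) ξ‖ₑ) + ‖rectFourierIntegral (φ n) R ξ - 𝓕 (⇑(φ n)) ξ‖ₑ :=
        (enorm_add_le _ _).trans (add_le_add_left ((enorm_add_le _ _).trans
          (add_le_add_left hb _)) _)
    _ = h n ξ + ‖rectFourierIntegral (φ n) R ξ - 𝓕 (⇑(φ n)) ξ‖ₑ := by
        simp only [hh, Pi.add_apply]; rw [hTξ n]
    _ < ε / 2 + ε / 2 := ENNReal.add_lt_add hn hR1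
    _ = ε := ENNReal.add_halves ε

end Convergence

/-! ### Lower bounds for oscillatory integrals. -/

section OscillatoryIntegral

theorem continuous_intervalIntegral_sin (b ν : ℝ) :
    Continuous fun s : ℝ => ∫ w in (0 : ℝ)..b, Real.sin (2 * Real.pi * ν * s * w) :=
  intervalIntegral.continuous_parametric_intervalIntegral_of_continuous'
    (by fun_prop) 0 b

theorem intervalIntegral_sin_mul {c : ℝ} (hc : c ≠ 0) (b : ℝ) :
    ∫ w in (0 : ℝ)..b, Real.sin (c * w) = (1 - Real.cos (c * b)) / c := by
  rw [intervalIntegral.integral_comp_mul_left _ hc, integral_sin]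
  simp [div_eq_inv_mul]

theorem intervalIntegral_one_sub_cos_period {x : ℝ} (hx : 0 < x) (m : ℕ) :
    ∫ s in ((m + 1 : ℝ) * (1 / (2 * x)))..((m + 2 : ℝ) * (1 / (2 * x))),
      (1 - Real.cos (4 * Real.pi * x * s)) = 1 / (2 * x) := by
  have hc : 4 * Real.pi * x ≠ 0 := by positivity
  rw [intervalIntegral.integral_sub (by simp) (Continuous.intervalIntegrable (by fun_prop) _ _),
    intervalIntegral.integral_comp_mul_left _ hc, integral_cos]
  have h1 : 4 * Real.pi * x * ((m + 1 : ℝ) * (1 / (2 * x))) = (2 * (m + 1) : ℕ) * Real.pi := by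
    push_cast; field_simp; ring
  have h2 : 4 * Real.pi * x * ((m + 2 : ℝ) * (1 / (2 * x))) = (2 * (m + 2) : ℕ) * Real.pi := by
    push_cast; field_simp; ring
  rw [h1, h2, Real.sin_nat_mul_pi, Real.sin_nat_mul_pi]
  simp
  ring

/-- The logarithmic growth of the double sine integral. -/
theorem sum_le_integral_integral_sin {x y : ℝ} (hx : 1 ≤ x) (hy : 1 ≤ y) {N : ℕ} (hN : 1 ≤ N) :
    (N : ℝ) / (2 * Real.pi) * ∑ k ∈ Finset.range N, 1 / ((k : ℝ) + 2) ≤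
      ∫ s in (0 : ℝ)..(2 * (y * N)), ∫ w in (0 : ℝ)..(2 * (x * N)),
        Real.sin (2 * Real.pi * (1 / N) * s * w) := by
  have hN0 : (1 : ℝ) ≤ N := by exact_mod_cast hN
  have hx0 : 0 < x := by linarith
  set h : ℝ → ℝ := fun s => ∫ w in (0 : ℝ)..(2 * (x * N)), Real.sin (2 * Real.pi * (1 / N) * s * w)
    with hh
  have hhc : Continuous h := continuous_intervalIntegral_sin _ _
  have hform : ∀ s, 0 < s → h s = N / (2 * Real.pi) * ((1 - Real.cos (4 * Real.pi * x * s)) / s) := by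
    intro s hs
    simp only [hh]
    rw [intervalIntegral_sin_mul (by positivity)]
    have : 2 * Real.pi * (1 / N) * s * (2 * (x * N)) = 4 * Real.pi * x * s := by
      field_simp; ring
    rw [this]
    field_simp
  have hnn : ∀ s, 0 < s → 0 ≤ h s := fun s hs => by
    rw [hform s hs]
    have := Real.cos_le_one (4 * Real.pi * x * s)
    have : 0 ≤ 1 - Real.cos (4 * Real.pi * x * s) := by linarith
    positivity
  -- P is the period of cos(4πxs). On the k-th period used, 1/s is at least 1/((k+2)P), and the mean
  -- of 1 - cos is 1, so a harmonic sum appears. The initial interval [0, P] is discarded.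
  set P : ℝ := 1 / (2 * x) with hP
  have hP0 : 0 < P := by positivity
  have hPle : P ≤ 1 / 2 := by
    rw [hP]; exact one_div_le_one_div_of_le (by norm_num) (by linarith)
  have hmono : ∫ s in ((0 : ℕ) + 1 : ℝ) * P..((N : ℕ) + 1 : ℝ) * P, h s ≤
      ∫ s in (0 : ℝ)..(2 * (y * N)), h s := by
    refine intervalIntegral.integral_mono_interval (by positivity) ?_ ?_ ?_
      (hhc.intervalIntegrable _ _)
    · gcongr; simp
    · nlinarith
    · exact (ae_restrict_mem measurableSet_Ioc).mono fun s hs => hnn s hs.1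
  have hsplit := intervalIntegral.sum_integral_adjacent_intervals (μ := volume) (f := h) (n := N)
    (a := fun k : ℕ => ((k : ℝ) + 1) * P) (fun k _ => hhc.intervalIntegrable _ _)
  refine le_trans ?_ hmono
  rw [← hsplit, Finset.mul_sum]
  refine Finset.sum_le_sum fun k _ => ?_
  have hk : ((k + 1 : ℕ) : ℝ) + 1 = k + 2 := by push_cast; ring
  rw [hk]
  calc (N : ℝ) / (2 * Real.pi) * (1 / ((k : ℝ) + 2))
      = ∫ s in ((k : ℝ) + 1) * P..((k : ℝ) + 2) * P,
          N / (2 * Real.pi) / ((k + 2) * P) * (1 - Real.cos (4 * Real.pi * x * s)) := by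
        rw [intervalIntegral.integral_const_mul, intervalIntegral_one_sub_cos_period hx0, ← hP]
        field_simp
    _ ≤ ∫ s in ((k : ℝ) + 1) * P..((k : ℝ) + 2) * P, h s := by
        refine intervalIntegral.integral_mono_on (by gcongr; norm_num)
          (Continuous.intervalIntegrable (by fun_prop) _ _) (hhc.intervalIntegrable _ _)
          fun s hs => ?_
        have hs0 : 0 < s := lt_of_lt_of_le (by positivity) hs.1
        rw [hform s hs0, div_mul_eq_mul_div, mul_div_assoc]
        have := Real.cos_le_one (4 * Real.pi * x * s)
        have : 0 ≤ 1 - Real.cos (4 * Real.pi * x * s) := by linarith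
        gcongr
        exact hs.2

theorem tendsto_sum_one_div_add_two :
    Tendsto (fun N : ℕ => ∑ k ∈ Finset.range N, 1 / ((k : ℝ) + 2)) atTop atTop := by
  have h := (tendsto_add_atTop_iff_nat 1).2 Real.tendsto_sum_range_one_div_nat_succ_atTop
  have h2 := tendsto_atTop_add_const_right atTop (-1) h
  refine h2.congr fun N => ?_
  rw [Finset.sum_range_succ']
  simp
  refine Finset.sum_congr rfl fun k _ => ?_
  ring

/-- Completing the product turns the phase into (z₁ + yN)(z₂ + xN)/N minus the constant xyN. A
unimodular factor removes the constant and makes the real part a sine; translating the rectangle to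
have a corner at the origin gives the double sine integral. -/
theorem sum_le_norm_integral_exp {x y : ℝ} (hx : 1 ≤ x) (hy : 1 ≤ y) {N : ℕ} (hN : 1 ≤ N) :
    (N : ℝ) / (2 * Real.pi) * ∑ k ∈ Finset.range N, 1 / ((k : ℝ) + 2) ≤
      ‖∫ z in Set.Icc (-(y * N)) (y * N) ×ˢ Set.Icc (-(x * N)) (x * N),
        Complex.exp (-2 * Real.pi * Complex.I * ((1 / N * (z.1 * z.2) + z.1 * x + z.2 * y : ℝ) : ℂ))‖ := by
  have hN0 : (1 : ℝ) ≤ N := by exact_mod_cast hN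
  set a := y * N with ha
  set b := x * N with hb
  have ha0 : 0 ≤ a := by positivity
  have hb0 : 0 ≤ b := by positivity
  set c : ℂ := Complex.I * Complex.exp (((-2 * Real.pi * (x * y * N) : ℝ) : ℂ) * Complex.I) with hc
  have hc1 : ‖c‖ = 1 := by
    rw [hc, norm_mul, Complex.norm_I, Complex.norm_exp_ofReal_mul_I, one_mul]
  set G : ℝ × ℝ → ℂ := fun z =>
    Complex.exp (-2 * Real.pi * Complex.I * ((1 / N * (z.1 * z.2) + z.1 * x + z.2 * y : ℝ) : ℂ))
    with hG
  have hGc : Continuous G := by fun_prop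
  have hre : ∀ z, (c * G z).re = Real.sin (2 * Real.pi * (1 / N) * (z.1 + a) * (z.2 + b)) := by
    intro z
    have : c * G z = Complex.I * Complex.exp
        (((-(2 * Real.pi * (1 / N) * (z.1 + a) * (z.2 + b)) : ℝ) : ℂ) * Complex.I) := by
      rw [hc, hG, mul_assoc, ← Complex.exp_add, ha, hb]
      congr 2
      push_cast
      have : (N : ℂ) ≠ 0 := by exact_mod_cast (by linarith : (N : ℝ) ≠ 0)
      field_simp
      ring
    rw [this, Complex.I_mul_re, Complex.exp_ofReal_mul_I_im, Real.sin_neg, neg_neg]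
  have hcomp : IsCompact (Set.Icc (-a) a ×ˢ Set.Icc (-b) b) := isCompact_Icc.prod isCompact_Icc
  have hval : (∫ z in Set.Icc (-a) a ×ˢ Set.Icc (-b) b, c * G z).re =
      ∫ s in (0 : ℝ)..(2 * a), ∫ w in (0 : ℝ)..(2 * b),
        Real.sin (2 * Real.pi * (1 / N) * s * w) := by
    have hint : IntegrableOn (fun z => c * G z) (Set.Icc (-a) a ×ˢ Set.Icc (-b) b) :=
      (by fun_prop : Continuous fun z => c * G z).continuousOn.integrableOn_compact hcomp
    rw [← Complex.reCLM_apply, ← Complex.reCLM.integral_comp_comm hint]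
    simp only [Complex.reCLM_apply, hre]
    have hint2 : IntegrableOn (fun z : ℝ × ℝ =>
        Real.sin (2 * Real.pi * (1 / N) * (z.1 + a) * (z.2 + b)))
        (Set.Icc (-a) a ×ˢ Set.Icc (-b) b) (volume.prod volume) :=
      (by fun_prop : Continuous fun z : ℝ × ℝ =>
        Real.sin (2 * Real.pi * (1 / N) * (z.1 + a) * (z.2 + b))).continuousOn.integrableOn_compact hcomp
    rw [Measure.volume_eq_prod, setIntegral_prod _ hint2]
    simp only [integral_Icc_eq_integral_Ioc]
    rw [← intervalIntegral.integral_of_le (by linarith)]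
    simp only [← intervalIntegral.integral_of_le (show -b ≤ b by linarith)]
    have hinner : ∀ s : ℝ, ∫ w in (-b)..b, Real.sin (2 * Real.pi * (1 / N) * (s + a) * (w + b)) =
        ∫ w in (0 : ℝ)..(2 * b), Real.sin (2 * Real.pi * (1 / N) * (s + a) * w) := fun s => by
      rw [intervalIntegral.integral_comp_add_right
        (fun w => Real.sin (2 * Real.pi * (1 / N) * (s + a) * w)) b, neg_add_cancel, two_mul b]
    simp only [hinner]
    rw [intervalIntegral.integral_comp_add_right (fun s => ∫ w in (0 : ℝ)..(2 * b),
      Real.sin (2 * Real.pi * (1 / N) * s * w)) a, neg_add_cancel, two_mul a]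
  calc _ ≤ _ := sum_le_integral_integral_sin hx hy hN
    _ = (∫ z in Set.Icc (-a) a ×ˢ Set.Icc (-b) b, c * G z).re := hval.symm
    _ ≤ ‖∫ z in Set.Icc (-a) a ×ˢ Set.Icc (-b) b, c * G z‖ := Complex.re_le_norm _
    _ = _ := by rw [integral_const_mul, norm_mul, hc1, one_mul]

/-- For the remaining coordinates: the phase stays below π/3 in absolute value, so the cosine is at
least 1/2 on an interval of length 1/2. -/
theorem one_div_four_le_norm_integral_exp {η : ℝ} (hη : |η| ≤ 1 / 8) :
    1 / 4 ≤ ‖∫ t in Set.Icc (-(1 / 4 : ℝ)) (1 / 4),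
      Complex.exp (-2 * Real.pi * Complex.I * ((t * η : ℝ) : ℂ))‖ := by
  have hint : IntegrableOn (fun t : ℝ => Complex.exp (-2 * Real.pi * Complex.I * ((t * η : ℝ) : ℂ)))
      (Set.Icc (-(1 / 4 : ℝ)) (1 / 4)) :=
    (by fun_prop : Continuous fun t : ℝ =>
      Complex.exp (-2 * Real.pi * Complex.I * ((t * η : ℝ) : ℂ))).continuousOn.integrableOn_compact
      isCompact_Icc
  have hre : ∀ t : ℝ, (Complex.exp (-2 * Real.pi * Complex.I * ((t * η : ℝ) : ℂ))).re =
      Real.cos (2 * Real.pi * (t * η)) := fun t => by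
    have : -2 * Real.pi * Complex.I * ((t * η : ℝ) : ℂ) =
        ((-(2 * Real.pi * (t * η)) : ℝ) : ℂ) * Complex.I := by push_cast; ring
    rw [this, Complex.exp_ofReal_mul_I_re, Real.cos_neg]
  refine le_trans ?_ (Complex.re_le_norm _)
  rw [← Complex.reCLM_apply, ← Complex.reCLM.integral_comp_comm hint]
  simp only [Complex.reCLM_apply, hre]
  calc (1 / 4 : ℝ) = ∫ t in Set.Icc (-(1 / 4 : ℝ)) (1 / 4), (1 / 2 : ℝ) := by
        simp; norm_num
    _ ≤ _ := by
        refine setIntegral_mono_on (by simp) ?_ measurableSet_Icc fun t ht => ?_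
        · exact (by fun_prop : Continuous fun t : ℝ => Real.cos (2 * Real.pi * (t * η))
            ).continuousOn.integrableOn_compact isCompact_Icc
        · rw [← Real.cos_pi_div_three, ← Real.cos_abs (2 * Real.pi * (t * η))]
          have ht' : |t| ≤ 1 / 4 := abs_le.2 ht
          have h1 : |t| * |η| ≤ 1 / 4 * (1 / 8) := by gcongr
          have h2 : |2 * Real.pi * (t * η)| ≤ Real.pi / 3 := by
            rw [abs_mul, abs_mul t, abs_of_pos (by positivity : 0 < 2 * Real.pi)]
            nlinarith [Real.pi_pos]
          exact Real.cos_le_cos_of_nonneg_of_le_pi (abs_nonneg _) (by linarith [Real.pi_pos]) h2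

end OscillatoryIntegral

/-! ### The chirp in dimension n + 2 and the choice of scales. -/

section Divergence

variable {n : ℕ}

/-- The half side lengths `(a, b, c, …, c)` of a box in `ℝ^(n + 2)`. -/
def boxRadii (n : ℕ) (a b c : ℝ) : Fin (n + 2) → ℝ :=
  Fin.cons a (Fin.cons b fun _ => c)

theorem mem_centeredBox_boxRadii {a b c : ℝ} {x : EuclideanSpace ℝ (Fin (n + 2))} :
    x ∈ centeredBox (boxRadii n a b c) ↔
      |x 0| ≤ a ∧ |x 1| ≤ b ∧ ∀ j : Fin n, |x j.succ.succ| ≤ c := by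
  simp only [centeredBox, Set.mem_ofPred_eq, Fin.forall_fin_succ, boxRadii, Fin.cons_zero,
    Fin.cons_succ, Set.mem_Icc, ← abs_le]
  rfl

theorem volume_centeredBox {d : ℕ} (R : Fin d → ℝ) :
    volume (centeredBox R) = ∏ j, ENNReal.ofReal (2 * R j) := by
  have h := (EuclideanSpace.volume_preserving_symm_measurableEquiv_toLp (Fin d)).measure_preimage
    (measurableSet_Icc (a := fun j => -R j) (b := R)).nullMeasurableSet
  rw [Real.volume_Icc_pi] at h
  convert h using 2
  · ext x
    simp only [centeredBox, Set.mem_preimage, ← Set.pi_univ_Icc, Set.mem_univ_pi]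
    rfl
  · ring_nf

theorem volume_centeredBox_boxRadii (a b c : ℝ) :
    volume (centeredBox (boxRadii n a b c)) =
      ENNReal.ofReal (2 * a) * (ENNReal.ofReal (2 * b) * ENNReal.ofReal (2 * c) ^ n) := by
  rw [volume_centeredBox, Fin.prod_univ_succ, Fin.prod_univ_succ]
  simp [boxRadii]

/-- Fubini's theorem for a function of two coordinates times a product over the others. -/
theorem integral_two_mul_prod (A : ℝ × ℝ → ℂ) (g : Fin n → ℝ → ℂ) :
    ∫ x : EuclideanSpace ℝ (Fin (n + 2)), A (x 0, x 1) * ∏ j : Fin n, g j (x j.succ.succ) =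
      (∫ z, A z) * ∏ j, ∫ t, g j t := by
  let e₁ := (MeasurableEquiv.toLp 2 (Fin (n + 2) → ℝ)).symm
  let e₂ := MeasurableEquiv.piFinSuccAbove (fun _ : Fin (n + 2) => ℝ) 0
  let e₃ := MeasurableEquiv.prodCongr (MeasurableEquiv.refl ℝ)
    (MeasurableEquiv.piFinSuccAbove (fun _ : Fin (n + 1) => ℝ) 0)
  let e₄ := (MeasurableEquiv.prodAssoc (α := ℝ) (β := ℝ) (γ := Fin n → ℝ)).symm
  have h₁ : MeasurePreserving e₁ volume volume :=
    EuclideanSpace.volume_preserving_symm_measurableEquiv_toLp _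
  have h₂ : MeasurePreserving e₂ volume volume := volume_preserving_piFinSuccAbove _ _
  have h₃ : MeasurePreserving e₃ volume volume :=
    (MeasurePreserving.id volume).prod (volume_preserving_piFinSuccAbove _ _)
  have h₄ : MeasurePreserving e₄ volume volume :=
    MeasurePreserving.symm _ volume_preserving_prodAssoc
  let e := ((e₁.trans e₂).trans e₃).trans e₄
  have he : MeasurePreserving e volume volume := h₄.comp (h₃.comp (h₂.comp h₁))
  have h := he.integral_comp' (fun w : (ℝ × ℝ) × (Fin n → ℝ) => A w.1 * ∏ j, g j (w.2 j))
  rw [← integral_fintype_prod_volume_eq_prod, ← integral_prod_mul, ← Measure.volume_eq_prod, ← h]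
  rfl

/-- The chirp couples only the first two coordinates, so the integral factors. -/
theorem rectFourierIntegral_oscillation (a b c μ : ℝ) (ξ : EuclideanSpace ℝ (Fin (n + 2))) :
    rectFourierIntegral (fun x : EuclideanSpace ℝ (Fin (n + 2)) =>
        Complex.exp (-2 * Real.pi * Complex.I * ((μ * (x 0 * x 1) : ℝ) : ℂ))) (boxRadii n a b c) ξ =
      (∫ z in Set.Icc (-a) a ×ˢ Set.Icc (-b) b, Complex.exp (-2 * Real.pi * Complex.I *
        ((μ * (z.1 * z.2) + z.1 * ξ 0 + z.2 * ξ 1 : ℝ) : ℂ))) *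
      ∏ j : Fin n, ∫ t in Set.Icc (-c) c,
        Complex.exp (-2 * Real.pi * Complex.I * ((t * ξ j.succ.succ : ℝ) : ℂ)) := by
  rw [rectFourierIntegral, ← integral_indicator (measurableSet_centeredBox _),
    ← integral_indicator (measurableSet_Icc.prod measurableSet_Icc)]
  simp only [← integral_indicator (measurableSet_Icc (a := -c) (b := c))]
  rw [← integral_two_mul_prod]
  congr 1
  ext x
  by_cases hx : x ∈ centeredBox (boxRadii n a b c)
  · obtain ⟨h0, h1, h2⟩ := mem_centeredBox_boxRadii.1 hx
    have hz : (x 0, x 1) ∈ Set.Icc (-a) a ×ˢ Set.Icc (-b) b := ⟨abs_le.1 h0, abs_le.1 h1⟩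
    have hj : ∀ j : Fin n, x j.succ.succ ∈ Set.Icc (-c) c := fun j => abs_le.1 (h2 j)
    rw [Set.indicator_of_mem hx, Set.indicator_of_mem hz,
      Finset.prod_congr rfl fun j _ => Set.indicator_of_mem (hj j) _,
      ← Complex.exp_sum, ← Complex.exp_add, ← Complex.exp_add]
    congr 1
    rw [Fin.sum_univ_succ, Fin.sum_univ_succ, ← Finset.mul_sum]
    push_cast
    simp only [Fin.succ_zero_eq_one]
    ring
  · rw [Set.indicator_of_notMem hx]
    by_cases hz : (x 0, x 1) ∈ Set.Icc (-a) a ×ˢ Set.Icc (-b) b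
    · obtain ⟨j, hj⟩ : ∃ j : Fin n, x j.succ.succ ∉ Set.Icc (-c) c := by
        by_contra! hcon
        exact hx (mem_centeredBox_boxRadii.2
          ⟨abs_le.2 hz.1, abs_le.2 hz.2, fun j => abs_le.2 (hcon j)⟩)
      rw [Finset.prod_eq_zero (Finset.mem_univ j) (Set.indicator_of_notMem hj _), mul_zero]
    · rw [Set.indicator_of_notMem hz, zero_mul]

theorem sum_le_norm_rectFourierIntegral_oscillation {ξ : EuclideanSpace ℝ (Fin (n + 2))}
    (h0 : 1 ≤ ξ 0) (h1 : 1 ≤ ξ 1) (h2 : ∀ j : Fin n, |ξ j.succ.succ| ≤ 1 / 8) {N : ℕ} (hN : 1 ≤ N) :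
    (N : ℝ) / (2 * Real.pi) * (∑ k ∈ Finset.range N, 1 / ((k : ℝ) + 2)) * (1 / 4) ^ n ≤
      ‖rectFourierIntegral (fun x : EuclideanSpace ℝ (Fin (n + 2)) =>
        Complex.exp (-2 * Real.pi * Complex.I * ((1 / N * (x 0 * x 1) : ℝ) : ℂ)))
        (boxRadii n (ξ 1 * N) (ξ 0 * N) (1 / 4)) ξ‖ := by
  rw [rectFourierIntegral_oscillation, norm_mul, norm_prod]
  refine mul_le_mul (sum_le_norm_integral_exp h0 h1 hN) ?_ (by positivity) (norm_nonneg _)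
  calc (1 / 4 : ℝ) ^ n = ∏ _j : Fin n, (1 / 4 : ℝ) := by simp
    _ ≤ _ := Finset.prod_le_prod (fun _ _ => by norm_num)
        fun j _ => one_div_four_le_norm_integral_exp (h2 j)

/-- A sequence of scales growing fast enough for the gliding hump. -/
theorem exists_scales (n : ℕ) : ∃ N : ℕ → ℕ, Monotone N ∧ (∀ m, 1 ≤ N m) ∧ (∀ m, m ≤ N m) ∧
    ∀ m : ℕ, (m : ℝ) + 32 * (N m) ^ 2 ≤ (1 / 2) ^ (m + 1) * (1 / (2 * Real.pi) *
      (∑ k ∈ Finset.range (N (m + 1)), 1 / ((k : ℝ) + 2)) * (1 / 4) ^ n) := by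
  -- The term 32a² is the error from the previous square: area at most 16a² times the pointwise
  -- bound 2. Divergence of the harmonic sum beats it despite the weight 2^{-(m+1)}.
  have hstep : ∀ m a : ℕ, ∃ b : ℕ, a ≤ b ∧ m + 1 ≤ b ∧
      (m : ℝ) + 32 * a ^ 2 ≤ (1 / 2) ^ (m + 1) * (1 / (2 * Real.pi) *
        (∑ k ∈ Finset.range b, 1 / ((k : ℝ) + 2)) * (1 / 4) ^ n) := by
    intro m a
    have h : Tendsto (fun b : ℕ => (1 / 2 : ℝ) ^ (m + 1) * (1 / (2 * Real.pi) *
        (∑ k ∈ Finset.range b, 1 / ((k : ℝ) + 2)) * (1 / 4) ^ n)) atTop atTop :=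
      ((tendsto_sum_one_div_add_two.const_mul_atTop (by positivity)).atTop_mul_const
        (by positivity)).const_mul_atTop (by positivity)
    obtain ⟨b, hb1, hb2, hb3⟩ := ((eventually_ge_atTop a).and ((eventually_ge_atTop (m + 1)).and
      (h.eventually_ge_atTop ((m : ℝ) + 32 * a ^ 2)))).exists
    exact ⟨b, hb1, hb2, hb3⟩
  choose g hg1 hg2 hg3 using hstep
  let N : ℕ → ℕ := fun m => Nat.rec 1 (fun m a => g m a) m
  have hN : Monotone N := monotone_nat_of_le_succ fun m => hg1 m (N m)
  refine ⟨N, hN, fun m => hN (Nat.zero_le m), fun m => ?_, fun m => hg3 m (N m)⟩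
  cases m with
  | zero => exact Nat.zero_le _
  | succ m => exact hg2 m (N m)

end Divergence

/-! ### The gliding hump and its unbounded partial integrals. -/

section GlidingHump

variable {n : ℕ}

/-- The `k`-th oscillating piece `2 ^ (-k) N⁻¹ exp(-2πi x₀ x₁ / N)`, where `N = N k`. -/
noncomputable def oscillatingPiece (n : ℕ) (N : ℕ → ℕ) (k : ℕ) (x : EuclideanSpace ℝ (Fin (n + 2))) : ℂ :=
  ((1 / 2) ^ k * (1 / N k) : ℝ) *
    Complex.exp (-2 * Real.pi * Complex.I * ((1 / N k * (x 0 * x 1) : ℝ) : ℂ))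

theorem continuous_oscillatingPiece (N : ℕ → ℕ) (k : ℕ) : Continuous (oscillatingPiece n N k) := by
  unfold oscillatingPiece; fun_prop

theorem norm_oscillatingPiece (N : ℕ → ℕ) (k : ℕ) (x : EuclideanSpace ℝ (Fin (n + 2))) :
    ‖oscillatingPiece n N k x‖ = (1 / 2) ^ k * (1 / N k) := by
  have : -2 * Real.pi * Complex.I * ((1 / N k * (x 0 * x 1) : ℝ) : ℂ) =
      ((-2 * Real.pi * (1 / N k * (x 0 * x 1)) : ℝ) : ℂ) * Complex.I := by push_cast; ring
  rw [oscillatingPiece, norm_mul, this, Complex.norm_exp_ofReal_mul_I, mul_one, Complex.norm_real,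
    Real.norm_of_nonneg (by positivity)]

theorem norm_oscillatingPiece_le_one (N : ℕ → ℕ) (k : ℕ) (x : EuclideanSpace ℝ (Fin (n + 2))) :
    ‖oscillatingPiece n N k x‖ ≤ 1 := by
  rw [norm_oscillatingPiece]
  refine mul_le_one₀ (pow_le_one₀ (by norm_num) (by norm_num)) (by positivity) ?_
  rw [one_div]
  exact Nat.cast_inv_le_one _

theorem exists_scale_ge {N : ℕ → ℕ} (hN : ∀ m, m ≤ N m) (x : EuclideanSpace ℝ (Fin (n + 2))) :
    ∃ k, |x 0| ≤ 2 * (N k : ℝ) ∧ |x 1| ≤ 2 * (N k : ℝ) := by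
  obtain ⟨k, hk⟩ := exists_nat_ge (max |x 0| |x 1|)
  have h1 : (k : ℝ) ≤ 2 * N k := by
    have : (k : ℝ) ≤ N k := by exact_mod_cast hN k
    linarith [(k.cast_nonneg : (0 : ℝ) ≤ k)]
  exact ⟨k, (le_max_left _ _).trans (hk.trans h1), (le_max_right _ _).trans (hk.trans h1)⟩

open Classical in
/-- The function that equals the `k`-th oscillating piece on the `k`-th of a sequence of nested
squares with the previous square removed, cut off to a strip in the other variables. -/
noncomputable def glidingHump {N : ℕ → ℕ} (hN : ∀ m, m ≤ N m) :
    EuclideanSpace ℝ (Fin (n + 2)) → ℂ :=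
  {x | ∀ j : Fin n, |x j.succ.succ| ≤ 1 / 4}.indicator
    fun x => oscillatingPiece n N (Nat.find (exists_scale_ge hN x)) x

variable {N : ℕ → ℕ} (hN : ∀ m, m ≤ N m)

theorem measurable_glidingHump : Measurable (glidingHump (n := n) hN) := by
  classical
  refine Measurable.indicator ?_ ?_
  · refine Measurable.find (fun k => (continuous_oscillatingPiece N k).measurable) (fun k => ?_)
      (exists_scale_ge hN)
    have hm : ∀ i, Measurable fun x : EuclideanSpace ℝ (Fin (n + 2)) => |x i| := fun i => by fun_prop
    exact (measurableSet_le (hm 0) measurable_const).inter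
      (measurableSet_le (hm 1) measurable_const)
  · have : {x : EuclideanSpace ℝ (Fin (n + 2)) | ∀ j : Fin n, |x j.succ.succ| ≤ 1 / 4} =
        ⋂ j : Fin n, {x | |x j.succ.succ| ≤ 1 / 4} := by ext; simp
    rw [this]
    exact MeasurableSet.iInter fun j => measurableSet_le (by fun_prop) measurable_const

theorem norm_glidingHump_le_one (x : EuclideanSpace ℝ (Fin (n + 2))) :
    ‖glidingHump hN x‖ ≤ 1 :=
  (norm_indicator_le_norm_self _ _).trans (norm_oscillatingPiece_le_one _ _ _)

theorem exists_mem_glidingHump_eq {x : EuclideanSpace ℝ (Fin (n + 2))} (hx : glidingHump hN x ≠ 0) :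
    ∃ k, x ∈ centeredBox (boxRadii n (2 * N k) (2 * N k) (1 / 4)) ∧
      glidingHump hN x = oscillatingPiece n N k x := by
  classical
  have hmem := Set.mem_of_indicator_ne_zero hx
  have hk := Nat.find_spec (exists_scale_ge hN x)
  refine ⟨Nat.find (exists_scale_ge hN x), mem_centeredBox_boxRadii.2 ⟨hk.1, hk.2, hmem⟩, ?_⟩
  rw [glidingHump, Set.indicator_of_mem hmem]

/-- The k-th piece has squared amplitude 4^{-k}/N_k² on a box of volume at most 16N_k², so the
squared L² norms are dominated by a geometric series. -/
theorem memLp_glidingHump (hN1 : ∀ m, 1 ≤ N m) : MemLp (glidingHump (n := n) hN) 2 volume := by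
  refine ⟨(measurable_glidingHump hN).aestronglyMeasurable, ?_⟩
  rw [eLpNorm_lt_top_iff_lintegral_rpow_enorm_lt_top (by norm_num) (by norm_num)]
  have hbox : ∀ k, MeasurableSet (centeredBox (boxRadii n (2 * N k) (2 * N k) (1 / 4))) :=
    fun k => measurableSet_centeredBox _
  have hsum : Summable fun k : ℕ => 16 * ((1 : ℝ) / 4) ^ k :=
    (summable_geometric_of_lt_one (by norm_num) (by norm_num)).mul_left _
  calc ∫⁻ x, ‖glidingHump (n := n) hN x‖ₑ ^ (2 : ℝ≥0∞).toReal
      ≤ ∫⁻ x, ∑' k, (centeredBox (boxRadii n (2 * N k) (2 * N k) (1 / 4))).indicator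
          (fun _ => ENNReal.ofReal (((1 / 2) ^ k * (1 / N k)) ^ 2)) x := by
        refine lintegral_mono fun x => ?_
        rcases eq_or_ne (glidingHump hN x) 0 with h | h
        · simp [h]
        · obtain ⟨k, hk, heq⟩ := exists_mem_glidingHump_eq hN h
          refine le_trans (le_of_eq ?_) (ENNReal.le_tsum k)
          rw [Set.indicator_of_mem hk, heq, ← ofReal_norm, norm_oscillatingPiece,
            ENNReal.ofReal_pow (by positivity)]
          simp
    _ = ∑' k, ENNReal.ofReal (((1 / 2) ^ k * (1 / N k)) ^ 2) *
          volume (centeredBox (boxRadii n (2 * N k) (2 * N k) (1 / 4))) := by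
        rw [lintegral_tsum fun k => (measurable_const.indicator (hbox k)).aemeasurable]
        exact tsum_congr fun k => lintegral_indicator_const (hbox k) _
    _ ≤ ∑' k, ENNReal.ofReal (16 * (1 / 4) ^ k) := by
        refine ENNReal.tsum_le_tsum fun k => ?_
        have hNk : (0 : ℝ) < N k := by exact_mod_cast hN1 k
        rw [volume_centeredBox_boxRadii]
        calc _ ≤ ENNReal.ofReal (((1 / 2) ^ k * (1 / N k)) ^ 2) *
              (ENNReal.ofReal (2 * (2 * N k)) * (ENNReal.ofReal (2 * (2 * N k)) * 1)) := by
              gcongr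
              exact pow_le_one₀ bot_le (by rw [ENNReal.ofReal_le_one]; norm_num)
          _ = ENNReal.ofReal (16 * (1 / 4) ^ k) := by
              rw [mul_one, ← ENNReal.ofReal_mul (by positivity), ← ENNReal.ofReal_mul (by positivity)]
              congr 1
              have : ((1 : ℝ) / 4) ^ k = ((1 / 2) ^ k) ^ 2 := by
                rw [← pow_mul, mul_comm, pow_mul]; norm_num
              rw [this]
              field_simp
              ring
    _ < ⊤ := by
        rw [← ENNReal.ofReal_tsum_of_nonneg (fun k => by positivity) hsum]
        exact ENNReal.ofReal_lt_top

/-- Outside the previous square the first admissible scale is exactly m + 1, by monotonicity of N,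
so the difference vanishes; inside, both functions are bounded by 1. -/
theorem norm_glidingHump_sub_oscillatingPiece_le (hmono : Monotone N) {m : ℕ}
    {x : EuclideanSpace ℝ (Fin (n + 2))}
    (hx : x ∈ centeredBox (boxRadii n (2 * N (m + 1)) (2 * N (m + 1)) (1 / 4))) :
    ‖glidingHump hN x - oscillatingPiece n N (m + 1) x‖ ≤
      (centeredBox (boxRadii n (2 * N m) (2 * N m) (1 / 4))).indicator (fun _ => (2 : ℝ)) x := by
  classical
  obtain ⟨h0, h1, h2⟩ := mem_centeredBox_boxRadii.1 hx
  by_cases hm : x ∈ centeredBox (boxRadii n (2 * N m) (2 * N m) (1 / 4))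
  · rw [Set.indicator_of_mem hm]
    refine (norm_sub_le _ _).trans ?_
    linarith [norm_glidingHump_le_one hN x, norm_oscillatingPiece_le_one (n := n) N (m + 1) x]
  · rw [Set.indicator_of_notMem hm]
    have hfind : Nat.find (exists_scale_ge hN x) = m + 1 := by
      refine le_antisymm (Nat.find_min' _ ⟨h0, h1⟩) ?_
      by_contra! hlt
      have hk := Nat.find_spec (exists_scale_ge hN x)
      have hle : (N (Nat.find (exists_scale_ge hN x)) : ℝ) ≤ N m := by
        exact_mod_cast hmono (Nat.lt_succ_iff.1 hlt)
      exact hm (mem_centeredBox_boxRadii.2 ⟨hk.1.trans (by gcongr), hk.2.trans (by gcongr), h2⟩)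
    have : glidingHump hN x = oscillatingPiece n N (m + 1) x := by
      rw [glidingHump, Set.indicator_of_mem (by exact h2), ← hfind]
    rw [this, sub_self, norm_zero]

/-- The hump is supported in the strip of half width 1/4, so the other radii may go to infinity
without changing the integral. -/
theorem rectFourierIntegral_glidingHump_eq {a b c : ℝ} (hc : 1 / 4 ≤ c)
    (ξ : EuclideanSpace ℝ (Fin (n + 2))) :
    rectFourierIntegral (glidingHump hN) (boxRadii n a b c) ξ =
      rectFourierIntegral (glidingHump hN) (boxRadii n a b (1 / 4)) ξ := by
  rw [← fourier_indicator_centeredBox, ← fourier_indicator_centeredBox]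
  refine congrArg (fun F : EuclideanSpace ℝ (Fin (n + 2)) → ℂ => 𝓕 F ξ) ?_
  rw [glidingHump, Set.indicator_indicator, Set.indicator_indicator]
  refine congrArg (fun s => Set.indicator s _) (Set.ext fun x => ?_)
  simp only [Set.mem_inter_iff, mem_centeredBox_boxRadii, Set.mem_ofPred_eq]
  exact ⟨fun h => ⟨⟨h.1.1, h.1.2.1, h.2⟩, h.2⟩,
    fun h => ⟨⟨h.1.1, h.1.2.1, fun j => (h.2 j).trans hc⟩, h.2⟩⟩

theorem norm_exp_pairing {d : ℕ} (x ξ : EuclideanSpace ℝ (Fin d)) :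
    ‖Complex.exp (-2 * Real.pi * Complex.I * (∑ j, x j * ξ j : ℝ))‖ = 1 := by
  have : -2 * Real.pi * Complex.I * ((∑ j, x j * ξ j : ℝ) : ℂ) =
      ((-2 * Real.pi * ∑ j, x j * ξ j : ℝ) : ℂ) * Complex.I := by push_cast; ring
  rw [this, Complex.norm_exp_ofReal_mul_I]

theorem norm_rectFourierIntegral_glidingHump_ge (hmono : Monotone N) (hN1 : ∀ m, 1 ≤ N m)
    {ξ : EuclideanSpace ℝ (Fin (n + 2))} (h0 : ξ 0 ∈ Set.Ioo 1 2) (h1 : ξ 1 ∈ Set.Ioo 1 2)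
    (h2 : ∀ j : Fin n, |ξ j.succ.succ| < 1 / 8) (m : ℕ) {c : ℝ} (hc : 1 / 4 ≤ c) :
    (1 / 2) ^ (m + 1) * (1 / (2 * Real.pi) *
      (∑ k ∈ Finset.range (N (m + 1)), 1 / ((k : ℝ) + 2)) * (1 / 4) ^ n) - 32 * (N m) ^ 2 ≤
      ‖rectFourierIntegral (glidingHump hN)
        (boxRadii n (ξ 1 * N (m + 1)) (ξ 0 * N (m + 1)) c) ξ‖ := by
  rw [rectFourierIntegral_glidingHump_eq hN hc]
  set ρ := boxRadii n (ξ 1 * N (m + 1)) (ξ 0 * N (m + 1)) (1 / 4) with hρ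
  set N' := N (m + 1) with hN'
  have hN'1 : (1 : ℝ) ≤ N' := by exact_mod_cast hN1 (m + 1)
  set E : EuclideanSpace ℝ (Fin (n + 2)) → ℂ := fun x =>
    Complex.exp (-2 * Real.pi * Complex.I * (∑ j, x j * ξ j : ℝ)) with hE
  have hEc : Continuous E := by fun_prop
  have hE1 : ∀ x, ‖E x‖ = 1 := fun x => norm_exp_pairing x ξ
  have hfin : volume (centeredBox ρ) < ⊤ := (isCompact_centeredBox ρ).measure_lt_top
  set B := centeredBox (boxRadii n (2 * N m) (2 * N m) (1 / 4)) with hB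
  have hBm : MeasurableSet B := measurableSet_centeredBox _
  have hBfin : volume B < ⊤ := (isCompact_centeredBox _).measure_lt_top
  have hint1 : IntegrableOn (fun x => glidingHump hN x * E x) (centeredBox ρ) :=
    IntegrableOn.of_bound hfin
      ((measurable_glidingHump hN).mul hEc.measurable).aestronglyMeasurable 1
      (Eventually.of_forall fun x => by
        rw [norm_mul, hE1, mul_one]; exact norm_glidingHump_le_one hN x)
  have hint2 : IntegrableOn (fun x => oscillatingPiece n N (m + 1) x * E x) (centeredBox ρ) :=
    ((continuous_oscillatingPiece N (m + 1)).mul hEc).continuousOn.integrableOn_compact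
      (isCompact_centeredBox ρ)
  have hosc : ∫ x in centeredBox ρ, oscillatingPiece n N (m + 1) x * E x =
      (((1 / 2) ^ (m + 1) * (1 / N') : ℝ) : ℂ) *
        rectFourierIntegral (fun x : EuclideanSpace ℝ (Fin (n + 2)) =>
          Complex.exp (-2 * Real.pi * Complex.I * ((1 / N' * (x 0 * x 1) : ℝ) : ℂ))) ρ ξ := by
    rw [rectFourierIntegral, ← integral_const_mul]
    refine integral_congr_ae (Eventually.of_forall fun x => ?_)
    simp only [oscillatingPiece, hE, hN']
    ring
  have hmain : (1 / 2) ^ (m + 1) * (1 / (2 * Real.pi) *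
      (∑ k ∈ Finset.range N', 1 / ((k : ℝ) + 2)) * (1 / 4) ^ n) ≤
      ‖∫ x in centeredBox ρ, oscillatingPiece n N (m + 1) x * E x‖ := by
    rw [hosc, norm_mul, Complex.norm_real, Real.norm_of_nonneg (by positivity)]
    have := sum_le_norm_rectFourierIntegral_oscillation h0.1.le h1.1.le (fun j => (h2 j).le)
      (hN1 (m + 1))
    calc _ = (1 / 2) ^ (m + 1) * (1 / N' : ℝ) * (N' / (2 * Real.pi) *
          (∑ k ∈ Finset.range N', 1 / ((k : ℝ) + 2)) * (1 / 4) ^ n) := by field_simp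
      _ ≤ _ := by gcongr
  have hvol : volume.real B ≤ 16 * (N m) ^ 2 := by
    have hvB : volume B ≤ ENNReal.ofReal (16 * (N m) ^ 2) := by
      rw [hB, volume_centeredBox_boxRadii]
      calc _ ≤ ENNReal.ofReal (2 * (2 * N m)) * (ENNReal.ofReal (2 * (2 * N m)) * 1) := by
            gcongr
            exact pow_le_one₀ bot_le (by rw [ENNReal.ofReal_le_one]; norm_num)
        _ = _ := by
            rw [mul_one, ← ENNReal.ofReal_mul (by positivity)]
            congr 1; ring
    exact ENNReal.toReal_le_of_le_ofReal (by positivity) hvB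
  -- The upper bound 2 on ξ₀ and ξ₁ keeps the rectangle inside the square where the hump is compared
  -- with the piece of index m + 1.
  have hsub : centeredBox ρ ⊆ centeredBox (boxRadii n (2 * N') (2 * N') (1 / 4)) := by
    intro x hx
    obtain ⟨g0, g1, g2⟩ := mem_centeredBox_boxRadii.1 hx
    exact mem_centeredBox_boxRadii.2 ⟨g0.trans (by gcongr; exact h1.2.le),
      g1.trans (by gcongr; exact h0.2.le), g2⟩
  have herr : ‖∫ x in centeredBox ρ, (glidingHump hN x * E x - oscillatingPiece n N (m + 1) x * E x)‖ ≤
      32 * (N m) ^ 2 := by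
    have hBi : Integrable (B.indicator fun _ => (2 : ℝ)) :=
      (integrable_indicator_iff hBm).2 (integrableOn_const hBfin.ne)
    calc _ ≤ ∫ x in centeredBox ρ, B.indicator (fun _ => (2 : ℝ)) x := by
          refine norm_integral_le_of_norm_le hBi.integrableOn ?_
          refine (ae_restrict_mem (measurableSet_centeredBox ρ)).mono fun x hx => ?_
          rw [← sub_mul, norm_mul, hE1, mul_one]
          exact norm_glidingHump_sub_oscillatingPiece_le hN hmono (hsub hx)
      _ ≤ ∫ x, B.indicator (fun _ => (2 : ℝ)) x :=
          setIntegral_le_integral hBi (Eventually.of_forall fun x =>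
            Set.indicator_nonneg (fun _ _ => by norm_num) x)
      _ = volume.real B * 2 := by rw [integral_indicator_const _ hBm, smul_eq_mul]
      _ ≤ _ := by linarith
  have hsplit : rectFourierIntegral (glidingHump hN) ρ ξ =
      (∫ x in centeredBox ρ, oscillatingPiece n N (m + 1) x * E x) +
        ∫ x in centeredBox ρ, (glidingHump hN x * E x - oscillatingPiece n N (m + 1) x * E x) := by
    rw [integral_sub hint1 hint2, rectFourierIntegral]
    ring
  rw [hsplit]
  have := norm_sub_le_norm_add (∫ x in centeredBox ρ, oscillatingPiece n N (m + 1) x * E x)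
    (∫ x in centeredBox ρ, (glidingHump hN x * E x - oscillatingPiece n N (m + 1) x * E x))
  linarith

theorem tendsto_boxRadii_atTop {u v w : ℕ → ℝ} (hu : Tendsto u atTop atTop)
    (hv : Tendsto v atTop atTop) (hw : Tendsto w atTop atTop) :
    Tendsto (fun m => boxRadii n (u m) (v m) (w m)) atTop atTop := by
  refine tendsto_atTop.2 fun R => ?_
  filter_upwards [hu.eventually_ge_atTop (R 0), hv.eventually_ge_atTop (R 1),
    eventually_all.2 fun j : Fin n => hw.eventually_ge_atTop (R j.succ.succ)] with m h0 h1 h2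
  exact Fin.forall_fin_succ.2 ⟨h0, Fin.forall_fin_succ.2 ⟨h1, h2⟩⟩

theorem exists_memLp_limsup_rectFourierIntegral_eq_top (n : ℕ) :
    ∃ f : EuclideanSpace ℝ (Fin (n + 2)) → ℂ, MemLp f 2 volume ∧
      ∃ Q : Set (EuclideanSpace ℝ (Fin (n + 2))), MeasurableSet Q ∧ 0 < volume Q ∧
        ∀ ξ ∈ Q, limsup (fun R : Fin (n + 2) → ℝ => ‖rectFourierIntegral f R ξ‖ₑ) atTop = ⊤ := by
  obtain ⟨N, hmono, hN1, hN, hgrow⟩ := exists_scales n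
  set Q : Set (EuclideanSpace ℝ (Fin (n + 2))) :=
    {ξ | ξ 0 ∈ Set.Ioo 1 2} ∩ {ξ | ξ 1 ∈ Set.Ioo 1 2} ∩
      ⋂ j : Fin n, {ξ | |ξ j.succ.succ| < 1 / 8} with hQ
  have hQo : IsOpen Q := by
    refine ((isOpen_Ioo.preimage (by fun_prop)).inter (isOpen_Ioo.preimage (by fun_prop))).inter
      (isOpen_iInter_of_finite fun j => isOpen_lt (by fun_prop) continuous_const)
  have hQne : Q.Nonempty := by
    refine ⟨WithLp.toLp 2 (boxRadii n (3 / 2) (3 / 2) 0), ⟨?_, ?_⟩, ?_⟩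
    · change (3 / 2 : ℝ) ∈ Set.Ioo 1 2; norm_num
    · change (3 / 2 : ℝ) ∈ Set.Ioo 1 2; norm_num
    · refine Set.mem_iInter.2 fun j => ?_
      change |(0 : ℝ)| < 1 / 8
      norm_num
  refine ⟨glidingHump hN, memLp_glidingHump hN hN1, Q, hQo.measurableSet,
    hQo.measure_pos _ hQne, fun ξ hξ => ?_⟩
  obtain ⟨⟨h0, h1⟩, h2⟩ := hξ
  have h2' : ∀ j : Fin n, |ξ j.succ.succ| < 1 / 8 := fun j => Set.mem_iInter.1 h2 j
  have hNt : Tendsto (fun m => (N (m + 1) : ℝ)) atTop atTop := by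
    refine tendsto_atTop_mono (fun m => ?_) tendsto_natCast_atTop_atTop
    exact_mod_cast (Nat.le_succ m).trans (hN (m + 1))
  -- The radii depend on ξ, and the last entry m + 1 is chosen only so that every side tends to
  -- infinity.
  have hR : Tendsto (fun m : ℕ => boxRadii n (ξ 1 * N (m + 1)) (ξ 0 * N (m + 1)) (m + 1)) atTop
      atTop :=
    tendsto_boxRadii_atTop (hNt.const_mul_atTop (zero_lt_one.trans h1.1))
      (hNt.const_mul_atTop (zero_lt_one.trans h0.1))
      (tendsto_atTop_add_const_right _ _ tendsto_natCast_atTop_atTop)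
  have hlarge : ∀ m : ℕ, (m : ℝ≥0∞) ≤ ‖rectFourierIntegral (glidingHump hN)
      (boxRadii n (ξ 1 * N (m + 1)) (ξ 0 * N (m + 1)) (m + 1)) ξ‖ₑ := by
    intro m
    have hc : (1 : ℝ) / 4 ≤ m + 1 := by linarith [(m.cast_nonneg : (0 : ℝ) ≤ m)]
    have h := norm_rectFourierIntegral_glidingHump_ge hN hmono hN1 h0 h1 h2' m hc
    have hg := hgrow m
    rw [← ofReal_norm, ← ENNReal.ofReal_natCast]
    exact ENNReal.ofReal_le_ofReal (by linarith)
  refine ENNReal.eq_top_of_forall_nnreal_le fun r => ?_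
  refine le_limsup_of_frequently_le (hR.frequently (Eventually.frequently ?_))
  obtain ⟨k, hk⟩ := exists_nat_ge r
  filter_upwards [eventually_ge_atTop k] with m hm
  refine le_trans ?_ (hlarge m)
  exact_mod_cast hk.trans (by exact_mod_cast hm)

theorem weakL2Norm_eq_top {α : Type*} [MeasurableSpace α] {μ : Measure α} {g : α → ℝ≥0∞} {Q : Set α}
    (hQ : 0 < μ Q) (hg : ∀ x ∈ Q, g x = ⊤) : weakL2Norm μ g = ⊤ := by
  have hle : ∀ t : ℝ≥0, (t : ℝ≥0∞) * μ Q ^ (1 / 2 : ℝ) ≤ weakL2Norm μ g := fun t => by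
    refine le_trans ?_ (le_iSup (fun t : ℝ≥0 =>
      (t : ℝ≥0∞) * μ {x | (t : ℝ≥0∞) < g x} ^ (1 / 2 : ℝ)) t)
    gcongr
    intro x hx
    simp [hg x hx]
  have hpos : μ Q ^ (1 / 2 : ℝ) ≠ 0 := by
    simp [hQ.ne']
  refine top_le_iff.1 ?_
  rw [← ENNReal.top_mul hpos, ← ENNReal.iSup_natCast, ENNReal.iSup_mul]
  exact iSup_le fun k => by simpa using hle k

theorem maximalRectFourier_eq_top {d : ℕ} {f : EuclideanSpace ℝ (Fin d) → ℂ}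
    {ξ : EuclideanSpace ℝ (Fin d)}
    (h : limsup (fun R : Fin d → ℝ => ‖rectFourierIntegral f R ξ‖ₑ) atTop = ⊤) :
    maximalRectFourier f ξ = ⊤ := by
  refine top_le_iff.1 (h ▸ limsup_le_of_le (by isBoundedDefault) ?_)
  filter_upwards [eventually_ge_atTop fun _ => (1 : ℝ)] with R hR
  exact enorm_rectFourierIntegral_le (fun j => zero_lt_one.trans_le (hR j)) ξ

end GlidingHump

theorem theorem2 (d : ℕ) (hd : 1 ≤ d) :
    -- part (a): maximal estimate and almost everywhere convergence, for `1 ≤ p < 2` and `q = p'`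
    (∀ (p q : ℝ≥0∞) [Fact (1 ≤ p)] [Fact (1 ≤ q)], p < 2 → ENNReal.HolderConjugate p q →
      (∃ C : ℝ≥0, ∀ f : EuclideanSpace ℝ (Fin d) → ℂ, MemLp f p volume →
        eLpNorm (maximalRectFourier f) q volume ≤ C * eLpNorm f p volume) ∧
      (∃ T : Lp (α := EuclideanSpace ℝ (Fin d)) ℂ p volume →L[ℂ]
          Lp (α := EuclideanSpace ℝ (Fin d)) ℂ q volume,
        IsFourierExtension T ∧
        ∀ (f : EuclideanSpace ℝ (Fin d) → ℂ) (hf : MemLp f p volume),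
          ∀ᵐ ξ ∂(volume : Measure (EuclideanSpace ℝ (Fin d))),
            Tendsto (fun R : Fin d → ℝ => rectFourierIntegral f R ξ) atTop
              (𝓝 (T (hf.toLp f) ξ)))) ∧
    -- part (b): unbounded divergence on a set of positive measure, and failure of the weak bound
    (2 ≤ d →
      (∃ f : EuclideanSpace ℝ (Fin d) → ℂ, MemLp f 2 volume ∧
        ∃ Q : Set (EuclideanSpace ℝ (Fin d)), MeasurableSet Q ∧ 0 < volume Q ∧
          ∀ ξ ∈ Q, limsup (fun R : Fin d → ℝ => ‖rectFourierIntegral f R ξ‖ₑ) atTop = ⊤) ∧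
      ¬ ∃ C : ℝ≥0, ∀ f : EuclideanSpace ℝ (Fin d) → ℂ, MemLp f 2 volume →
        weakL2Norm volume (maximalRectFourier f) ≤ C * eLpNorm f 2 volume) := by
  refine ⟨fun p q _ _ hp2 hpq => ?_, fun hd2 => ?_⟩
  · have hpT : p ≠ ⊤ := (hp2.trans (by norm_num)).ne
    obtain ⟨C, hC⟩ := exists_eLpNorm_maximalRectFourier_le (d := d) Fact.out hp2 hpq
    obtain ⟨T, hT⟩ := exists_isFourierExtension hpT hC
    exact ⟨⟨C, hC⟩, T, hT, fun f hf => hT.ae_tendsto_rectFourierIntegral hpT hC hf⟩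
  · obtain ⟨n, rfl⟩ := Nat.exists_eq_add_of_le' hd2
    obtain ⟨f, hf, Q, hQm, hQ, hlim⟩ := exists_memLp_limsup_rectFourierIntegral_eq_top n
    refine ⟨⟨f, hf, Q, hQm, hQ, hlim⟩, fun ⟨C, hC⟩ => ?_⟩
    have h := hC f hf
    rw [weakL2Norm_eq_top hQ fun ξ hξ => maximalRectFourier_eq_top (hlim ξ hξ)] at h
    exact (ENNReal.mul_lt_top ENNReal.coe_lt_top hf.2).not_ge h
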